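/- For $n\ge 0$ let $B_n$ be the number of partitions of a set with $n$ elements (into non-empty blocks) and, for a set $\mathcal{S}$ of positive integers, let $B_{n,\mathcal{S}}$ be the number of those partitions none of whose blocks has its size in $\mathcal{S}$. Let $r=r(n)$ be the solution of $re^r=n$, and let $\alpha(z)=\alpha_{\mathcal{S}}(z)=\sum_{k\in\mathcal{S}} z^k/k!$. Let $\eta_1=0.1866823\ldots<\eta_2=2.1555352\ldots$ be the two real solutions of $\eta(1-\log\eta)=1/2$, and let $0<\delta_1<\eta_1<\eta_2<\delta_2$. Then the proportion of set partitions of $n$ objects whose block sizes are not in $\mathcal{S}$ satisfies $$\frac{B_{n,\mathcal{S}}}{B_n}=\exp\bigl(-\alpha(r)\bigr)\left(1+O\left(\frac{1+(\alpha'(r))^2}{e^r}\right)\right)=\exp\bigl(-\alpha(r)\bigr)\bigl(1+o(1)\bigr)$$ as $n\to\infty$, uniformly for sets $\mathcal{S}$ with $\mathcal{S}\cap[\delta_1 r,\delta_2 r]=\emptyset$; the constant implied by the $O$ depends only on $\delta_1,\delta_2$, the bound holds for all $n\ge 0$, and the $o(1)$ tends to zero uniformly in $\mathcal{S}$. Moreover,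 for every fixed $c>0$, the relative error is $O\bigl((\alpha'(r))^2/e^r\bigr)$, uniformly for those of these sets $\mathcal{S}$ that are empty or satisfy $\alpha'(r)\ge c$, with an implied constant that depends only on $\delta_1,\delta_2,c$. -/

import Mathlib

noncomputable section

namespace SetPartitions

/-- For every natural number `n`, the equation `x * exp x = n` has exactly one real solution. -/
theorem existsUnique_mul_exp_eq (n : ℕ) : ∃! x : ℝ, x * Real.exp x = n := by
  have hn : (0 : ℝ) ≤ n := Nat.cast_nonneg n
  have hcont : ContinuousOn (fun x : ℝ => x * Real.exp x) (Set.Icc 0 (n : ℝ)) := by fun_prop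
  have hmem : (n : ℝ) ∈ Set.Icc ((0 : ℝ) * Real.exp 0) ((n : ℝ) * Real.exp n) := by
    refine ⟨by simp, ?_⟩
    have h1 : (1 : ℝ) ≤ Real.exp n := Real.one_le_exp hn
    nlinarith
  obtain ⟨x, -, hx⟩ := intermediate_value_Icc hn hcont hmem
  have nonneg : ∀ y : ℝ, y * Real.exp y = n → 0 ≤ y := by
    intro y hy
    by_contra hlt
    have : y * Real.exp y < 0 := mul_neg_of_neg_of_pos (not_le.mp hlt) (Real.exp_pos y)
    linarith
  have key : ∀ y z : ℝ, 0 ≤ y → y < z → y * Real.exp y < z * Real.exp z := by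
    intro y z hy hyz
    have h1 : Real.exp y < Real.exp z := Real.exp_lt_exp.mpr hyz
    have h2 := Real.exp_pos y
    nlinarith
  refine ⟨x, hx, fun y hy => ?_⟩
  have hx' : x * Real.exp x = n := hx
  have hy' : y * Real.exp y = n := hy
  rcases lt_trichotomy y x with h | h | h
  · have := key y x (nonneg y hy') h
    linarith
  · exact h
  · have := key x y (nonneg x hx') h
    linarith

/-- `r n` is the solution of `r * exp r = n` (the Lambert function at `n`). -/
def r (n : ℕ) : ℝ := (existsUnique_mul_exp_eq n).choose

theorem r_mul_exp_r (n : ℕ) : r n * Real.exp (r n) = n :=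
  (existsUnique_mul_exp_eq n).choose_spec.1

/-- The function `α_S(z) = ∑_{k ∈ S} z ^ k / k!`. -/
def alpha (S : Set ℕ) (z : ℝ) : ℝ := ∑' k : S, z ^ (k : ℕ) / (Nat.factorial k : ℝ)

/-- The number of partitions of a set with `n` elements. -/
def numPartitions (n : ℕ) : ℕ :=
  Nat.card (Finpartition (Finset.univ : Finset (Fin n)))

/-- The number of partitions of a set with `n` elements, none of whose blocks has its size
in `S`. -/
def numPartitionsAvoiding (n : ℕ) (S : Set ℕ) : ℕ :=
  Nat.card {P : Finpartition (Finset.univ : Finset (Fin n)) // ∀ b ∈ P.parts, b.card ∉ S}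

/-- `S` is a set of positive integers, none of which lies in `[δ₁ r(n), δ₂ r(n)]`. -/
def Admissible (δ₁ δ₂ : ℝ) (n : ℕ) (S : Set ℕ) : Prop :=
  0 ∉ S ∧ ∀ k ∈ S, (k : ℝ) ∉ Set.Icc (δ₁ * r n) (δ₂ * r n)

end SetPartitions

end

noncomputable section

namespace SetPartitions

open Finset

/-! The exponential generating function of the partitions avoiding S is exp(e^z - 1 - α(z)), so
Cauchy's formula on |z| = r writes B_{n,S} as an integral over θ. Dividing by the same formula for S
= ∅ turns the relative error into the quotient of ∫ saddle · (exp(Δ) - 1) by ∫ saddle, where Δ(θ) =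
α(r) - α(re^{iθ}) and `saddle` is a peak of width about e^{-r/2}/r.

Put A = α'(r). Then exp(Δ) - 1 = -iθrA + O((1 + A²) r²θ² e^{Ar|θ|}). Against the peak, a
second-order remainder gains a factor e^{-r} (`exists_norm_integral_saddle_mul_le`), which is the
claimed error. The linear term, estimated by absolute values, would cost A e^{-r/2}. But the
derivative of `saddle` integrates to zero over a period, so the first moment of `saddle` is governed
by a second-order remainder too (`integral_saddle_mul_id`). The denominator is at least a constant
times the peak width (`exists_le_norm_integral_saddle`).

The bounds depend on S only through A. The gap in S around r gives A ≤ D e^{κr} with κ < 1/2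
(`exists_deriv_alpha_le`): a Chernoff bound produces the exponents δ(1 - log δ), and η₁, η₂ are
where these equal 1/2. Hence A² e^{-r} stays bounded, Gaussian decay absorbs e^{Ar|θ|} uniformly in
S, and the error tends to zero. -/

/-! ### Recursion for partitions with forbidden block sizes -/

/-- The number of partitions of the finite set `s` with no block of size in `S`. -/
def countAvoiding {α : Type*} [DecidableEq α] (S : Set ℕ) (s : Finset α) : ℕ :=
  Nat.card {P : Finpartition s // ∀ b ∈ P.parts, b.card ∉ S}

/-- Deleting the block `insert a T` is a bijection, with inverse `Finpartition.extend`. -/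
theorem countAvoiding_fiber {α : Type*} [DecidableEq α] (S : Set ℕ) {s T : Finset α} {a : α}
    (ha : a ∉ s) (hT : T ⊆ s) (hS : T.card + 1 ∉ S) :
    Nat.card {P : Finpartition (insert a s) //
      (∀ b ∈ P.parts, b.card ∉ S) ∧ insert a T ∈ P.parts} = countAvoiding S (s \ T) := by
  have haT : a ∉ T := fun h => ha (hT h)
  have hne : insert a T ≠ (⊥ : Finset α) := insert_ne_empty a T
  have hdis : Disjoint (s \ T) (insert a T) := by
    rw [disjoint_insert_right]
    exact ⟨fun h => ha (mem_sdiff.1 h).1, sdiff_disjoint⟩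
  have hsup : s \ T ⊔ insert a T = insert a s := by
    ext x
    simp only [sup_eq_union, mem_union, mem_sdiff, mem_insert]
    have := @hT x
    tauto
  have hnot : ∀ Q : Finpartition (s \ T), insert a T ∉ Q.parts := fun Q h =>
    ha (mem_sdiff.1 (Q.subset h (mem_insert_self a T))).1
  have hext : ∀ Q : {P : Finpartition (s \ T) // ∀ b ∈ P.parts, b.card ∉ S},
      (∀ b ∈ (Q.1.extend hne hdis hsup).parts, b.card ∉ S) ∧
        insert a T ∈ (Q.1.extend hne hdis hsup).parts := by
    refine fun Q => ⟨fun b hb => ?_, mem_insert_self _ _⟩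
    rcases mem_insert.1 hb with rfl | hb
    · rwa [card_insert_of_notMem haT]
    · exact Q.2 b hb
  refine (Nat.card_congr (Equiv.ofBijective
    (fun Q => ⟨Q.1.extend hne hdis hsup, hext Q⟩) ⟨?_, ?_⟩)).symm
  · intro Q Q' h
    have h1 := congrArg (fun P => P.1.parts) h
    simp only [Finpartition.extend_parts] at h1
    apply Subtype.ext
    apply Finpartition.ext
    rw [← erase_insert (hnot Q.1), h1, erase_insert (hnot Q'.1)]
  · rintro ⟨P, hP, hmem⟩
    have hU : (P.parts.erase (insert a T)).sup id = s \ T := by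
      ext x
      simp only [mem_sup, mem_erase, id, mem_sdiff]
      constructor
      · rintro ⟨v, ⟨hv1, hv2⟩, hx⟩
        have hd := P.disjoint hv2 hmem hv1
        have hxs := P.subset hv2 hx
        have hx' := disjoint_left.1 hd hx
        simp only [id, mem_insert, not_or] at hx' hxs
        exact ⟨hxs.resolve_left hx'.1, hx'.2⟩
      · rintro ⟨hxs, hxT⟩
        obtain ⟨t, ht, hxt⟩ := P.exists_mem (mem_insert_of_mem hxs)
        refine ⟨t, ⟨?_, ht⟩, hxt⟩
        rintro rfl
        rcases mem_insert.1 hxt with rfl | h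
        · exact ha hxs
        · exact hxT h
    refine ⟨⟨P.ofSubset (erase_subset _ _) hU, fun b hb => hP b (erase_subset _ _ hb)⟩, ?_⟩
    apply Subtype.ext
    apply Finpartition.ext
    simp only [Finpartition.extend_parts, Finpartition.ofSubset_parts]
    exact insert_erase hmem

/-- Partitions are classified by the block of `a`; `T` is that block without `a`, hence the size
`T.card + 1`. -/
theorem countAvoiding_insert {α : Type*} [DecidableEq α] (S : Set ℕ) [DecidablePred (· ∈ S)]
    {s : Finset α} {a : α} (ha : a ∉ s) :
    countAvoiding S (insert a s) =
      ∑ T ∈ s.powerset, if T.card + 1 ∈ S then 0 else countAvoiding S (s \ T) := by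
  classical
  rw [countAvoiding, Nat.card_eq_fintype_card, Fintype.card_subtype]
  rw [card_eq_sum_card_fiberwise (f := fun P => (P.part a).erase a) (t := s.powerset)]
  · refine sum_congr rfl fun T hT => ?_
    rw [mem_powerset] at hT
    have haT : a ∉ T := fun h => ha (hT h)
    have key : ∀ P : Finpartition (insert a s),
        (P.part a).erase a = T ↔ insert a T ∈ P.parts := by
      intro P
      have hmem : a ∈ P.part a := P.mem_part_self.2 (mem_insert_self a s)
      constructor
      · rintro rfl
        rw [insert_erase hmem]
        exact P.part_mem.2 (mem_insert_self a s)
      · intro h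
        rw [P.part_eq_of_mem h (mem_insert_self a T), erase_insert haT]
    rw [filter_filter]
    simp only [key]
    split_ifs with hS
    · rw [card_eq_zero, filter_eq_empty_iff]
      rintro P - ⟨h1, h2⟩
      refine h1 _ h2 ?_
      rwa [card_insert_of_notMem haT]
    · rw [← countAvoiding_fiber S ha hT hS, Nat.card_eq_fintype_card, Fintype.card_subtype]
  · intro P _
    rw [mem_coe, mem_powerset]
    intro x hx
    have := P.part_subset a (mem_of_mem_erase hx)
    exact (mem_insert.1 this).resolve_left (ne_of_mem_erase hx)

theorem countAvoiding_empty {α : Type*} [DecidableEq α] (S : Set ℕ) :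
    countAvoiding S (∅ : Finset α) = 1 := by
  rw [countAvoiding, Nat.card_eq_one_iff_unique]
  constructor
  · refine ⟨fun P Q => Subtype.ext ?_⟩
    exact (inferInstance : Subsingleton (Finpartition (⊥ : Finset α))).elim _ _
  · refine ⟨⟨Finpartition.empty _, ?_⟩⟩
    intro b hb
    simp at hb

theorem countAvoiding_insert_of_card {α : Type*} [DecidableEq α] (S : Set ℕ)
    [DecidablePred (· ∈ S)] {s : Finset α} {a : α} (ha : a ∉ s) {n : ℕ} (hn : s.card = n)
    (f : ℕ → ℕ) (hf : ∀ T ⊆ s, countAvoiding S (s \ T) = f (n - T.card)) :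
    countAvoiding S (insert a s) =
      ∑ k ∈ range (n + 1), n.choose k * if k + 1 ∈ S then 0 else f (n - k) := by
  have h := sum_powerset_apply_card (fun k => if k + 1 ∈ S then 0 else f (n - k)) (x := s)
  rw [countAvoiding_insert S ha, ← hn]
  rw [← hn] at h
  simp only [smul_eq_mul] at h
  rw [← h]
  refine sum_congr rfl fun T hT => ?_
  rw [hf T (mem_powerset.1 hT), hn]

/-- Both sides obey the same recursion, so strong induction replaces a transport of partitions along
a bijection. -/
theorem countAvoiding_eq_range {α : Type} [DecidableEq α] (S : Set ℕ) (n : ℕ) :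
    ∀ s : Finset α, s.card = n → countAvoiding S s = countAvoiding S (range n) := by
  classical
  induction n using Nat.strong_induction_on generalizing α with
  | _ n ih =>
    intro s hs
    rcases n with _ | n
    · rw [card_eq_zero] at hs
      rw [hs, range_zero, countAvoiding_empty, countAvoiding_empty]
    · obtain ⟨a, s', ha, rfl, hs'⟩ := card_eq_succ.1 hs
      rw [range_add_one,
        countAvoiding_insert_of_card S ha hs' (fun k => countAvoiding S (range k)),
        countAvoiding_insert_of_card S notMem_range_self (card_range n)
          (fun k => countAvoiding S (range k))]
      · exact fun T hT => ih _ (by omega) _ (by rw [card_sdiff_of_subset hT, card_range])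
      · intro T hT
        exact ih _ (by omega) _ (by rw [card_sdiff_of_subset hT, hs'])

theorem numPartitionsAvoiding_zero (S : Set ℕ) : numPartitionsAvoiding 0 S = 1 :=
  countAvoiding_empty S

theorem numPartitionsAvoiding_succ (S : Set ℕ) [DecidablePred (· ∈ S)] (n : ℕ) :
    numPartitionsAvoiding (n + 1) S = ∑ k ∈ range (n + 1),
      n.choose k * if k + 1 ∈ S then 0 else numPartitionsAvoiding (n - k) S := by
  have h : ∀ m, numPartitionsAvoiding m S = countAvoiding S (range m) := fun m =>
    countAvoiding_eq_range S m _ (by simp)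
  simp only [h]
  rw [range_add_one, countAvoiding_insert_of_card S notMem_range_self (card_range n)
    (fun k => countAvoiding S (range k)), ← range_add_one]
  exact fun T hT => countAvoiding_eq_range S _ _ (by rw [card_sdiff_of_subset hT, card_range])

theorem numPartitionsAvoiding_empty (n : ℕ) : numPartitionsAvoiding n ∅ = numPartitions n := by
  unfold numPartitionsAvoiding numPartitions
  exact Nat.card_congr (Equiv.subtypeUnivEquiv (by simp))

theorem numPartitionsAvoiding_le (n : ℕ) (S : Set ℕ) :
    numPartitionsAvoiding n S ≤ numPartitions n :=
  Nat.card_le_card_of_injective _ Subtype.val_injective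

theorem numPartitions_pos (n : ℕ) : 0 < numPartitions n :=
  Nat.card_pos

/-! ### Exponential generating functions with bounded coefficients -/

/-- The exponential generating function `∑ b k * z ^ k / k!`. -/
def egf (𝕜 : Type*) [RCLike 𝕜] (b : ℕ → ℝ) (z : 𝕜) : 𝕜 :=
  ∑' k : ℕ, (b k : 𝕜) * (z ^ k / (k.factorial : 𝕜))

section
variable {𝕜 : Type*} [RCLike 𝕜] {b : ℕ → ℝ}

theorem norm_egf_term_le (hb : ∀ k, |b k| ≤ 1) (z : 𝕜) (k : ℕ) :
    ‖(b k : 𝕜) * (z ^ k / (k.factorial : 𝕜))‖ ≤ ‖z‖ ^ k / (k.factorial : ℝ) := by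
  rw [norm_mul, norm_div, norm_pow, RCLike.norm_natCast, RCLike.norm_ofReal]
  exact mul_le_of_le_one_left (by positivity) (hb k)

theorem summable_egf (hb : ∀ k, |b k| ≤ 1) (z : 𝕜) :
    Summable fun k => (b k : 𝕜) * (z ^ k / (k.factorial : 𝕜)) :=
  .of_norm_bounded (Real.summable_pow_div_factorial ‖z‖) (norm_egf_term_le hb z)

/-- Termwise differentiation on the ball of radius `‖z‖ + 1`, where the exponential series is a
majorant; it shifts the coefficients by one. -/
theorem hasDerivAt_egf (hb : ∀ k, |b k| ≤ 1) (z : 𝕜) :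
    HasDerivAt (egf 𝕜 b) (egf 𝕜 (fun k => b (k + 1)) z) z := by
  have hsum : Summable fun k : ℕ => (k : ℝ) * ((‖z‖ + 1) ^ (k - 1) / (k.factorial : ℝ)) := by
    rw [← summable_nat_add_iff 1]
    refine (Real.summable_pow_div_factorial (‖z‖ + 1)).congr fun k => ?_
    rw [Nat.factorial_succ, Nat.add_sub_cancel]
    push_cast
    field_simp
  have h := hasDerivAt_tsum_of_isPreconnected (𝕜 := 𝕜)
    (g := fun k y => (b k : 𝕜) * (y ^ k / (k.factorial : 𝕜)))
    (g' := fun k y => (b k : 𝕜) * ((k : 𝕜) * y ^ (k - 1) / (k.factorial : 𝕜)))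
    hsum (t := Metric.ball 0 (‖z‖ + 1)) Metric.isOpen_ball
    (convex_ball _ _).isPreconnected
    (fun k y _ => ((hasDerivAt_pow k y).div_const _).const_mul _) ?_ (y₀ := z) (y := z)
    (by simp) (summable_egf hb z) (by simp)
  · have hval : egf 𝕜 (fun k => b (k + 1)) z =
        ∑' k : ℕ, (b k : 𝕜) * ((k : 𝕜) * z ^ (k - 1) / (k.factorial : 𝕜)) := by
      have hs : Summable fun k : ℕ => (b k : 𝕜) * ((k : 𝕜) * z ^ (k - 1) / (k.factorial : 𝕜)) := by
        rw [← summable_nat_add_iff 1]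
        refine (summable_egf (𝕜 := 𝕜) (b := fun k => b (k + 1)) (fun k => hb _) z).congr fun k => ?_
        have : ((k : 𝕜) + 1) ≠ 0 := by exact_mod_cast k.succ_ne_zero
        have : (k.factorial : 𝕜) ≠ 0 := by exact_mod_cast k.factorial_ne_zero
        rw [Nat.factorial_succ, Nat.add_sub_cancel]
        push_cast
        field_simp
      rw [hs.tsum_eq_zero_add, egf]
      simp only [Nat.cast_zero, zero_mul, zero_div, mul_zero, zero_add]
      refine tsum_congr fun k => ?_
      have : ((k : 𝕜) + 1) ≠ 0 := by exact_mod_cast k.succ_ne_zero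
      have : (k.factorial : 𝕜) ≠ 0 := by exact_mod_cast k.factorial_ne_zero
      rw [Nat.factorial_succ, Nat.add_sub_cancel]
      push_cast
      field_simp
    rw [hval]
    exact h
  · intro k y hy
    rw [mem_ball_zero_iff] at hy
    rw [norm_mul, norm_div, norm_mul, norm_pow, RCLike.norm_natCast, RCLike.norm_natCast,
      RCLike.norm_ofReal, mul_div_assoc]
    refine (mul_le_of_le_one_left (by positivity) (hb k)).trans ?_
    gcongr

theorem differentiable_egf (hb : ∀ k, |b k| ≤ 1) : Differentiable 𝕜 (egf 𝕜 b) :=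
  fun z => (hasDerivAt_egf hb z).differentiableAt

theorem egf_zero : egf 𝕜 b 0 = b 0 := by
  rw [egf, tsum_eq_single 0]
  · simp
  · intro k hk
    simp [hk]

theorem iteratedDeriv_egf (hb : ∀ k, |b k| ≤ 1) (k : ℕ) :
    iteratedDeriv k (egf 𝕜 b) = egf 𝕜 (fun j => b (j + k)) := by
  induction k with
  | zero => simp
  | succ k ih =>
    rw [iteratedDeriv_succ, ih]
    funext z
    rw [(hasDerivAt_egf (fun j => hb _) z).deriv]
    simp only [add_right_comm, add_assoc]

end

/-! ### The generating function of the avoiding partitions and Cauchy's formula -/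

/-- The `0`-`1` sequence of membership in `S`. -/
def ind (S : Set ℕ) : ℕ → ℝ := S.indicator 1

theorem ind_nonneg (S : Set ℕ) (k : ℕ) : 0 ≤ ind S k :=
  Set.indicator_nonneg (fun _ _ => zero_le_one) k

theorem ind_le_one (S : Set ℕ) (k : ℕ) : ind S k ≤ 1 :=
  Set.indicator_le_self' (f := (1 : ℕ → ℝ)) (fun _ _ => zero_le_one) k

theorem abs_ind_le (S : Set ℕ) (k : ℕ) : |ind S k| ≤ 1 := by
  rw [abs_of_nonneg (ind_nonneg S k)]
  exact ind_le_one S k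

theorem alpha_eq_egf (S : Set ℕ) : alpha S = egf ℝ (ind S) := by
  funext x
  rw [alpha, egf, tsum_subtype S (fun k : ℕ => x ^ k / (k.factorial : ℝ))]
  refine tsum_congr fun k => ?_
  by_cases hk : k ∈ S <;> simp [ind, hk]

theorem deriv_alpha (S : Set ℕ) (x : ℝ) :
    deriv (alpha S) x = egf ℝ (fun k => ind S (k + 1)) x := by
  rw [alpha_eq_egf, (hasDerivAt_egf (abs_ind_le S) x).deriv]

/-- The exponential generating function of the set partitions that avoid block sizes in `S`. -/
def genFun (S : Set ℕ) (z : ℂ) : ℂ := Complex.exp (Complex.exp z - 1 - egf ℂ (ind S) z)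

theorem differentiable_genFun (S : Set ℕ) : Differentiable ℂ (genFun S) := by
  have := differentiable_egf (𝕜 := ℂ) (abs_ind_le S)
  unfold genFun
  fun_prop

theorem deriv_genFun (S : Set ℕ) :
    deriv (genFun S) = (Complex.exp - egf ℂ (fun k => ind S (k + 1))) * genFun S := by
  funext z
  have h := (((Complex.hasDerivAt_exp z).sub_const 1).sub
    (hasDerivAt_egf (abs_ind_le S) z)).cexp.deriv
  simp only [Pi.mul_apply, Pi.sub_apply]
  rw [mul_comm]
  exact h

/-- Leibniz's rule at 0 for G' = (e^z - α'(z)) G is the recursion `numPartitionsAvoiding_succ`; 0 ∉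
S gives G(0) = 1. -/
theorem iteratedDeriv_genFun (S : Set ℕ) (hS : 0 ∉ S) (n : ℕ) :
    iteratedDeriv n (genFun S) 0 = numPartitionsAvoiding n S := by
  classical
  induction n using Nat.strong_induction_on with
  | _ n ih =>
    rcases n with _ | n
    · rw [iteratedDeriv_zero, numPartitionsAvoiding_zero, genFun, egf_zero]
      simp [ind, hS]
    · have h1 : ContDiff ℂ n (egf ℂ (fun k => ind S (k + 1))) :=
        (differentiable_egf fun k => abs_ind_le S _).contDiff
      have h2 : ContDiff ℂ n (genFun S) := (differentiable_genFun S).contDiff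
      have h3 : ContDiff ℂ n Complex.exp := Complex.contDiff_exp
      have h4 : ContDiff ℂ n (Complex.exp - egf ℂ (fun k => ind S (k + 1))) := h3.sub h1
      rw [iteratedDeriv_succ', deriv_genFun,
        iteratedDeriv_mul h4.contDiffAt h2.contDiffAt, numPartitionsAvoiding_succ]
      push_cast
      refine sum_congr rfl fun k hk => ?_
      have hk' : (k : WithTop ℕ∞) ≤ n := by
        exact_mod_cast Nat.lt_succ_iff.1 (mem_range.1 hk)
      rw [ih (n - k) (by omega), iteratedDeriv_sub (h3.of_le hk').contDiffAt
        (h1.of_le hk').contDiffAt, iteratedDeriv_egf (fun k => abs_ind_le S _), egf_zero,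
        iteratedDeriv_eq_iterate, Complex.iter_deriv_exp]
      by_cases h : k + 1 ∈ S <;> simp [ind, h]

theorem integral_genFun (S : Set ℕ) (hS : 0 ∉ S) (n : ℕ) {x : ℝ} (hx : 0 < x) :
    ∫ θ in -Real.pi..Real.pi, genFun S (x * Complex.exp (θ * Complex.I)) *
      Complex.exp (-(n * (θ * Complex.I))) =
        2 * Real.pi * x ^ n / n.factorial * numPartitionsAvoiding n S := by
  have h := (differentiable_genFun S).differentiableOn
    (s := Metric.closedBall 0 x) |>.circleIntegral_one_div_sub_center_pow_smul hx n
  rw [iteratedDeriv_genFun S hS, circleIntegral] at h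
  have hx' : (x : ℂ) ≠ 0 := by exact_mod_cast hx.ne'
  have hint : ∀ θ : ℝ, deriv (circleMap 0 x) θ •
      (1 / (circleMap 0 x θ - 0) ^ (n + 1)) • genFun S (circleMap 0 x θ) =
      (Complex.I / x ^ n) * (genFun S (x * Complex.exp (θ * Complex.I)) *
      Complex.exp (-(n * (θ * Complex.I)))) := by
    intro θ
    rw [deriv_circleMap, circleMap, Complex.exp_neg, Complex.exp_nat_mul]
    simp only [zero_add, sub_zero, smul_eq_mul]
    have := Complex.exp_ne_zero (θ * Complex.I)
    field_simp
    ring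
  simp only [hint] at h
  rw [intervalIntegral.integral_const_mul] at h
  -- The circle integral runs over [0, 2π]; periodicity moves it to [-π, π], centred at the peak.
  have hper : Function.Periodic (fun θ : ℝ => genFun S (x * Complex.exp (θ * Complex.I)) *
      Complex.exp (-(n * (θ * Complex.I)))) (2 * Real.pi) := by
    intro θ
    have h1 : Complex.exp (((θ + 2 * Real.pi : ℝ) : ℂ) * Complex.I) =
        Complex.exp (θ * Complex.I) := by
      push_cast
      rw [add_mul, Complex.exp_add, Complex.exp_two_pi_mul_I, mul_one]
    simp only [Complex.exp_neg, Complex.exp_nat_mul, h1]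
  have h2 := hper.intervalIntegral_add_eq (-Real.pi) 0
  rw [show -Real.pi + 2 * Real.pi = Real.pi by ring, zero_add] at h2
  rw [h2]
  have hn : (n.factorial : ℂ) ≠ 0 := by exact_mod_cast n.factorial_ne_zero
  have hI : Complex.I / x ^ n ≠ 0 := div_ne_zero Complex.I_ne_zero (pow_ne_zero _ hx')
  apply mul_left_cancel₀ hI
  rw [h, smul_eq_mul]
  field_simp

/-! ### Growth of α' and the exponent 1/2 -/

theorem hasSum_pow_div_factorial (x : ℝ) :
    HasSum (fun k : ℕ => x ^ k / (k.factorial : ℝ)) (Real.exp x) := by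
  rw [Real.exp_eq_exp_ℝ]
  exact NormedSpace.expSeries_div_hasSum_exp x

theorem mul_one_sub_log_eq (x : ℝ) : x * (1 - Real.log x) = x + Real.negMulLog x := by
  rw [Real.negMulLog]; ring

theorem strictConcaveOn_mul_one_sub_log :
    StrictConcaveOn ℝ (Set.Ici 0) fun x : ℝ => x * (1 - Real.log x) := by
  simp only [mul_one_sub_log_eq]
  exact (concaveOn_id (convex_Ici 0)).add_strictConcaveOn Real.strictConcaveOn_negMulLog

theorem min_lt_mul_one_sub_log {x y z : ℝ} (hx : 0 ≤ x) (hxy : x < y) (hyz : y < z) :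
    min (x * (1 - Real.log x)) (z * (1 - Real.log z)) < y * (1 - Real.log y) :=
  strictConcaveOn_mul_one_sub_log.lt_on_openSegment hx (hx.trans (hxy.trans hyz).le)
    (hxy.trans hyz).ne (by rw [openSegment_eq_Ioo (hxy.trans hyz)]; exact ⟨hxy, hyz⟩)

/-- By strict concavity the value 1/2 at η₁ exceeds the smaller of the values at δ₁ and η₂. Since
the value at 1 is 1, the same argument excludes 1 ≤ δ₁. -/
theorem cutoff_lower {η₁ η₂ δ₁ : ℝ} (hη : η₁ < η₂)
    (hη₁ : η₁ * (1 - Real.log η₁) = 1 / 2) (hη₂ : η₂ * (1 - Real.log η₂) = 1 / 2)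
    (hδ₀ : 0 < δ₁) (hδ₁ : δ₁ < η₁) : δ₁ < 1 ∧ δ₁ * (1 - Real.log δ₁) < 1 / 2 := by
  have h := min_lt_mul_one_sub_log hδ₀.le hδ₁ hη
  rw [hη₁, hη₂, min_lt_iff] at h
  have h' : δ₁ * (1 - Real.log δ₁) < 1 / 2 := h.resolve_right (lt_irrefl _)
  refine ⟨?_, h'⟩
  by_contra! h1
  have h2 := min_lt_mul_one_sub_log zero_le_one (h1.trans_lt hδ₁) hη
  rw [hη₁, hη₂, Real.log_one, min_lt_iff] at h2
  norm_num at h2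

theorem cutoff_upper {η₁ η₂ δ₂ : ℝ} (hη : η₁ < η₂)
    (hη₁ : η₁ * (1 - Real.log η₁) = 1 / 2) (hη₂ : η₂ * (1 - Real.log η₂) = 1 / 2)
    (hη₀ : 0 < η₁) (hδ₂ : η₂ < δ₂) : 1 < δ₂ ∧ δ₂ * (1 - Real.log δ₂) < 1 / 2 := by
  have h := min_lt_mul_one_sub_log hη₀.le hη hδ₂
  rw [hη₁, hη₂, min_lt_iff] at h
  have h' : δ₂ * (1 - Real.log δ₂) < 1 / 2 := h.resolve_left (lt_irrefl _)
  refine ⟨?_, h'⟩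
  by_contra! h1
  have h2 := min_lt_mul_one_sub_log hη₀.le hη (hδ₂.trans_le h1)
  rw [hη₁, hη₂, Real.log_one, min_lt_iff] at h2
  norm_num at h2

theorem deriv_alpha_nonneg (S : Set ℕ) {x : ℝ} (hx : 0 ≤ x) : 0 ≤ deriv (alpha S) x := by
  rw [deriv_alpha, egf]
  refine tsum_nonneg fun k => mul_nonneg (ind_nonneg S _) ?_
  positivity

/-- Chernoff's method: the weight δ₁^(k - δ₁x) is at least 1 when k + 1 < δ₁x, and δ₂^(k + 1 - δ₂x)
when k + 1 > δ₂x. Summing both weights over all k gives exponentials; the shift from k to k + 1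
costs the factor δ₂. -/
theorem deriv_alpha_le {δ₁ δ₂ : ℝ} (h₀ : 0 < δ₁) (h₁ : δ₁ ≤ 1) (h₂ : 1 ≤ δ₂) {S : Set ℕ} {x : ℝ}
    (hx : 0 ≤ x) (hS : ∀ k ∈ S, (k : ℝ) ∉ Set.Icc (δ₁ * x) (δ₂ * x)) :
    deriv (alpha S) x ≤ Real.exp (δ₁ * (1 - Real.log δ₁) * x) +
      δ₂ * Real.exp (δ₂ * (1 - Real.log δ₂) * x) := by
  have hδ₂ : 0 < δ₂ := by linarith
  have hs : ∀ δ : ℝ, HasSum (fun k : ℕ => Real.exp (-(δ * Real.log δ * x)) *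
      ((δ * x) ^ k / (k.factorial : ℝ))) (Real.exp (δ * (1 - Real.log δ) * x)) := by
    intro δ
    have := (hasSum_pow_div_factorial (δ * x)).mul_left (Real.exp (-(δ * Real.log δ * x)))
    rwa [← Real.exp_add, show -(δ * Real.log δ * x) + δ * x = δ * (1 - Real.log δ) * x by ring]
      at this
  have hsum := (hs δ₁).add ((hs δ₂).mul_left δ₂)
  rw [deriv_alpha, egf]
  have hpow : ∀ δ : ℝ, 0 < δ → ∀ k : ℕ, Real.exp (-(δ * Real.log δ * x)) *
      ((δ * x) ^ k / (k.factorial : ℝ)) =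
      Real.exp (Real.log δ * (k - δ * x)) * (x ^ k / (k.factorial : ℝ)) := by
    intro δ hδ k
    have h1 : Real.exp (Real.log δ * (k - δ * x)) =
        Real.exp (-(δ * Real.log δ * x)) * δ ^ k := by
      rw [← Real.exp_log (pow_pos hδ k), Real.log_pow, ← Real.exp_add]
      ring_nf
    rw [h1, mul_pow]
    ring
  refine hasSum_le ?_ (summable_egf (𝕜 := ℝ) (fun k => abs_ind_le S (k + 1)) x).hasSum hsum
  intro k
  simp only [hpow δ₁ h₀ k, hpow δ₂ hδ₂ k]
  have ht : 0 ≤ x ^ k / (k.factorial : ℝ) := by positivity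
  have hδ : Real.exp (Real.log δ₂ * (k + 1 - δ₂ * x)) =
      δ₂ * Real.exp (Real.log δ₂ * (k - δ₂ * x)) := by
    rw [show Real.log δ₂ * (k + 1 - δ₂ * x) = Real.log δ₂ + Real.log δ₂ * (k - δ₂ * x) by ring,
      Real.exp_add, Real.exp_log hδ₂]
  rw [← mul_assoc, ← hδ, ← add_mul]
  refine mul_le_mul_of_nonneg_right ?_ ht
  by_cases hk : k + 1 ∈ S
  · have h1 : ind S (k + 1) = 1 := by simp [ind, hk]
    have hlt := hS _ hk
    rw [Set.mem_Icc, not_and_or, not_le, not_le] at hlt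
    push_cast at hlt
    simp only [RCLike.ofReal_real_eq_id, id, h1]
    rcases hlt with hlt | hlt
    · have := Real.one_le_exp (mul_nonneg_of_nonpos_of_nonpos (Real.log_nonpos h₀.le h₁)
        (by linarith : (k : ℝ) - δ₁ * x ≤ 0))
      have := Real.exp_pos (Real.log δ₂ * (k + 1 - δ₂ * x))
      linarith
    · have := Real.one_le_exp (mul_nonneg (Real.log_nonneg h₂)
        (by linarith : 0 ≤ (k : ℝ) + 1 - δ₂ * x))
      have := Real.exp_pos (Real.log δ₁ * (k - δ₁ * x))
      linarith
  · have h0 : ind S (k + 1) = 0 := by simp [ind, hk]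
    simp only [h0, RCLike.ofReal_zero]
    positivity

theorem exists_deriv_alpha_le {η₁ η₂ δ₁ δ₂ : ℝ} (hη : η₁ < η₂)
    (hη₁ : η₁ * (1 - Real.log η₁) = 1 / 2) (hη₂ : η₂ * (1 - Real.log η₂) = 1 / 2)
    (hδ₀ : 0 < δ₁) (hδ₁ : δ₁ < η₁) (hδ₂ : η₂ < δ₂) :
    ∃ κ D : ℝ, 0 < κ ∧ κ < 1 / 2 ∧ 0 < D ∧ ∀ (S : Set ℕ) (x : ℝ), 0 ≤ x →
      (∀ k ∈ S, (k : ℝ) ∉ Set.Icc (δ₁ * x) (δ₂ * x)) →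
      deriv (alpha S) x ≤ D * Real.exp (κ * x) := by
  obtain ⟨h1, h2⟩ := cutoff_lower hη hη₁ hη₂ hδ₀ hδ₁
  obtain ⟨h3, h4⟩ := cutoff_upper hη hη₁ hη₂ (hδ₀.trans hδ₁) hδ₂
  -- The entry 1/4 only makes positivity of κ immediate.
  refine ⟨max (1 / 4) (max (δ₁ * (1 - Real.log δ₁)) (δ₂ * (1 - Real.log δ₂))), 1 + δ₂,
    lt_max_of_lt_left (by norm_num), max_lt (by norm_num) (max_lt h2 h4), by linarith,
    fun S x hx hS => (deriv_alpha_le hδ₀ h1.le h3.le hx hS).trans ?_⟩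
  rw [add_mul, one_mul]
  have hδ : 0 ≤ δ₂ := by linarith
  gcongr
  · exact (le_max_left _ _).trans (le_max_right _ _)
  · exact (le_max_right _ _).trans (le_max_right _ _)

/-! ### Expansion of α(x) - α(x e^{iθ}) at θ = 0 -/

/-- The term `[k ∈ S] x ^ k / k!` of the series `alpha S x`. -/
def term (S : Set ℕ) (x : ℝ) (k : ℕ) : ℝ := ind S k * (x ^ k / (k.factorial : ℝ))

theorem term_nonneg (S : Set ℕ) {x : ℝ} (hx : 0 ≤ x) (k : ℕ) : 0 ≤ term S x k :=
  mul_nonneg (ind_nonneg S k) (by positivity)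

theorem hasSum_term_mul (S : Set ℕ) (x : ℝ) :
    HasSum (fun k : ℕ => (k : ℝ) * term S x k) (x * deriv (alpha S) x) := by
  have h := (summable_egf (𝕜 := ℝ) (fun k => abs_ind_le S (k + 1)) x).hasSum.mul_left x
  rw [deriv_alpha, ← hasSum_nat_add_iff' 1]
  simp only [range_one, sum_singleton, Nat.cast_zero, zero_mul, sub_zero]
  refine h.congr_fun fun k => ?_
  have := k.factorial_ne_zero
  simp only [RCLike.ofReal_real_eq_id, id, term, Nat.factorial_succ]
  push_cast
  field_simp
  ring

/-- This controls second-order terms by α' alone. If k ≤ 8x, one factor k is at most 8x; otherwise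
k² ≤ 2e^k and e^(k - 8x) ≥ 1. The second kind sums to 2 exp((e² - 8)x) ≤ 2, whence the cutoff 8 >
e². -/
theorem sq_mul_term_le (S : Set ℕ) {x : ℝ} (hx : 0 ≤ x) (k : ℕ) :
    (k : ℝ) ^ 2 * term S x k ≤ 8 * x * (k * term S x k) +
      2 * Real.exp (-(8 * x)) * ((Real.exp 2 * x) ^ k / (k.factorial : ℝ)) := by
  have ht := term_nonneg S hx k
  have hk0 : (0 : ℝ) ≤ k := k.cast_nonneg
  have hp : 0 ≤ x ^ k / (k.factorial : ℝ) := by positivity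
  rcases le_or_gt (k : ℝ) (8 * x) with h | h
  · have h1 : (k : ℝ) ^ 2 * term S x k ≤ 8 * x * (k * term S x k) := by
      rw [pow_two, mul_assoc]
      exact mul_le_mul_of_nonneg_right h (mul_nonneg hk0 ht)
    have h2 : 0 ≤ 2 * Real.exp (-(8 * x)) * ((Real.exp 2 * x) ^ k / (k.factorial : ℝ)) := by
      positivity
    linarith
  · have h1 : (k : ℝ) ^ 2 ≤ 2 * Real.exp k := by
      have := Real.quadratic_le_exp_of_nonneg hk0
      nlinarith
    have h2 : (1 : ℝ) ≤ Real.exp (k - 8 * x) := Real.one_le_exp (by linarith)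
    have h3 : term S x k ≤ x ^ k / (k.factorial : ℝ) :=
      mul_le_of_le_one_left hp (ind_le_one S k)
    have h4 : 0 ≤ 8 * x * (k * term S x k) := by positivity
    have h5 : 2 * Real.exp (-(8 * x)) * ((Real.exp 2 * x) ^ k / (k.factorial : ℝ)) =
        2 * Real.exp k * Real.exp (k - 8 * x) * (x ^ k / (k.factorial : ℝ)) := by
      rw [mul_pow, ← Real.exp_nat_mul, sub_eq_add_neg, Real.exp_add,
        show (k : ℝ) * 2 = k + k by ring, Real.exp_add]
      ring
    rw [h5]
    have h6 : (k : ℝ) ^ 2 * term S x k ≤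
        2 * Real.exp k * Real.exp (k - 8 * x) * (x ^ k / (k.factorial : ℝ)) := by
      refine mul_le_mul (h1.trans ?_) h3 ht (by positivity)
      exact le_mul_of_one_le_right (by positivity) h2
    linarith

theorem exp_two_lt_eight : Real.exp 2 < 8 := by
  have h := Real.exp_one_lt_d9
  have h1 : Real.exp 2 = Real.exp 1 * Real.exp 1 := by rw [← Real.exp_add]; norm_num
  have h2 := Real.exp_pos 1
  rw [h1]
  nlinarith

theorem summable_sq_mul_term (S : Set ℕ) {x : ℝ} (hx : 0 ≤ x) :
    Summable fun k : ℕ => (k : ℝ) ^ 2 * term S x k :=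
  .of_nonneg_of_le (fun k => mul_nonneg (by positivity) (term_nonneg S hx k))
    (sq_mul_term_le S hx) (((hasSum_term_mul S x).summable.mul_left _).add
      ((hasSum_pow_div_factorial _).summable.mul_left _))

theorem tsum_sq_mul_term_le (S : Set ℕ) {x : ℝ} (hx : 0 ≤ x) :
    ∑' k : ℕ, (k : ℝ) ^ 2 * term S x k ≤ 8 * x ^ 2 * deriv (alpha S) x + 2 := by
  have h := hasSum_le (sq_mul_term_le S hx) (summable_sq_mul_term S hx).hasSum
    (((hasSum_term_mul S x).mul_left _).add
      ((hasSum_pow_div_factorial (Real.exp 2 * x)).mul_left _))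
  refine h.trans ?_
  rw [mul_assoc 2, ← Real.exp_add]
  have h1 : Real.exp (-(8 * x) + Real.exp 2 * x) ≤ 1 :=
    Real.exp_le_one_iff.2 (by nlinarith [exp_two_lt_eight])
  linarith

/-- The difference `α_S(x) - α_S(x * exp (i θ))`. -/
def alphaDiff (S : Set ℕ) (x θ : ℝ) : ℂ :=
  egf ℂ (ind S) x - egf ℂ (ind S) (x * Complex.exp (θ * Complex.I))

theorem hasSum_alphaDiff (S : Set ℕ) (x θ : ℝ) :
    HasSum (fun k : ℕ => (term S x k : ℂ) * (1 - Complex.exp (((k * θ : ℝ) : ℂ) * Complex.I)))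
      (alphaDiff S x θ) := by
  have h := (summable_egf (𝕜 := ℂ) (abs_ind_le S) x).hasSum.sub
    (summable_egf (𝕜 := ℂ) (abs_ind_le S) (x * Complex.exp (θ * Complex.I))).hasSum
  refine h.congr_fun fun k => ?_
  rw [mul_pow, ← Complex.exp_nat_mul, term]
  push_cast
  simp only [Complex.coe_algebraMap, mul_assoc]
  ring

theorem norm_alphaDiff_le (S : Set ℕ) {x : ℝ} (hx : 0 ≤ x) (θ : ℝ) :
    ‖alphaDiff S x θ‖ ≤ |θ| * (x * deriv (alpha S) x) := by
  refine (hasSum_alphaDiff S x θ).norm_le_of_bounded ((hasSum_term_mul S x).mul_left _) fun k => ?_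
  rw [norm_mul, Complex.norm_real, Real.norm_of_nonneg (term_nonneg S hx k), norm_sub_rev,
    mul_comm ((k * θ : ℝ) : ℂ)]
  have h := Real.norm_exp_I_mul_ofReal_sub_one_le (x := k * θ)
  rw [Real.norm_eq_abs, abs_mul, Nat.abs_cast] at h
  have := mul_le_mul_of_nonneg_left h (term_nonneg S hx k)
  linarith

theorem norm_exp_mul_I_sub_le (y : ℝ) :
    ‖Complex.exp (y * Complex.I) - 1 - y * Complex.I‖ ≤ 3 * y ^ 2 := by
  have hn : ‖(y : ℂ) * Complex.I‖ = |y| := by simp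
  rcases le_or_gt |y| 1 with h | h
  · have h1 := Complex.norm_exp_sub_one_sub_id_le (x := y * Complex.I) (by rwa [hn])
    rw [hn, sq_abs] at h1
    nlinarith [sq_nonneg y]
  · have h1 := Real.norm_exp_I_mul_ofReal_sub_one_le (x := y)
    rw [mul_comm Complex.I, Real.norm_eq_abs] at h1
    have h2 := norm_sub_le (Complex.exp (y * Complex.I) - 1) (y * Complex.I)
    rw [hn] at h2
    have h3 : |y| ≤ y ^ 2 := by
      rw [← sq_abs]
      nlinarith
    nlinarith

theorem norm_alphaDiff_add_le (S : Set ℕ) {x : ℝ} (hx : 1 ≤ x) (θ : ℝ) :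
    ‖alphaDiff S x θ + θ * (x * deriv (alpha S) x : ℝ) * Complex.I‖ ≤
      24 * (x ^ 2 * θ ^ 2) * (1 + deriv (alpha S) x) := by
  have hx0 : 0 ≤ x := by linarith
  have h0 := (Complex.hasSum_ofReal.2 (hasSum_term_mul S x)).mul_left (θ * Complex.I)
  have h1 := (hasSum_alphaDiff S x θ).add h0
  rw [show θ * (x * deriv (alpha S) x : ℝ) * Complex.I =
    θ * Complex.I * (x * deriv (alpha S) x : ℝ) by ring]
  refine (h1.norm_le_of_bounded
    ((summable_sq_mul_term S hx0).hasSum.mul_left (3 * θ ^ 2)) fun k => ?_).trans ?_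
  · have e : (term S x k : ℂ) * (1 - Complex.exp (((k * θ : ℝ) : ℂ) * Complex.I)) +
        θ * Complex.I * ((k * term S x k : ℝ) : ℂ) = -(term S x k : ℂ) *
        (Complex.exp (((k * θ : ℝ) : ℂ) * Complex.I) - 1 - ((k * θ : ℝ) : ℂ) * Complex.I) := by
      push_cast
      ring
    rw [e, norm_mul, norm_neg, Complex.norm_real, Real.norm_of_nonneg (term_nonneg S hx0 k)]
    have := mul_le_mul_of_nonneg_left (norm_exp_mul_I_sub_le (k * θ)) (term_nonneg S hx0 k)
    linarith
  · have h2 := tsum_sq_mul_term_le S hx0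
    have h3 := mul_le_mul_of_nonneg_left h2 (by positivity : 0 ≤ 3 * θ ^ 2)
    have h4 : 1 ≤ x ^ 2 := by nlinarith
    nlinarith [mul_le_mul_of_nonneg_left h4 (sq_nonneg θ)]

/-- The quadratic remainder of exp contributes A², and linearising `alphaDiff` contributes 24(1 + A)
≤ 36(1 + A²). -/
theorem norm_exp_alphaDiff_sub_le (S : Set ℕ) {x : ℝ} (hx : 1 ≤ x) (θ : ℝ) :
    ‖Complex.exp (alphaDiff S x θ) - 1 + θ * (x * deriv (alpha S) x : ℝ) * Complex.I‖ ≤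
      37 * (1 + deriv (alpha S) x ^ 2) *
        (x ^ 2 * θ ^ 2 * Real.exp (deriv (alpha S) x * (x * |θ|))) := by
  have hx0 : 0 ≤ x := by linarith
  set A := deriv (alpha S) x with hA
  have hA0 : 0 ≤ A := deriv_alpha_nonneg S hx0
  have h1 := norm_alphaDiff_le S hx0 θ
  have h2 := norm_alphaDiff_add_le S hx θ
  rw [← hA] at h1 h2
  have h3 := Complex.norm_exp_sub_sum_le_norm_mul_exp (alphaDiff S x θ) 2
  simp only [sum_range_succ, range_zero, sum_empty, pow_zero, Nat.factorial_zero, Nat.cast_one,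
    div_one, zero_add, pow_one, Nat.factorial_one] at h3
  have h4 : ‖alphaDiff S x θ‖ ^ 2 * Real.exp ‖alphaDiff S x θ‖ ≤
      (|θ| * (x * A)) ^ 2 * Real.exp (|θ| * (x * A)) := by gcongr
  rw [mul_pow, sq_abs] at h4
  have h5 : 1 ≤ Real.exp (A * (x * |θ|)) := Real.one_le_exp (by positivity)
  rw [show |θ| * (x * A) = A * (x * |θ|) by ring] at h4
  set e := Real.exp (A * (x * |θ|))
  have h6 := norm_add_le (Complex.exp (alphaDiff S x θ) - (1 + alphaDiff S x θ))
    (alphaDiff S x θ + θ * (x * A : ℝ) * Complex.I)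
  have h7 : 24 * (x ^ 2 * θ ^ 2) * (1 + A) ≤ 36 * (x ^ 2 * θ ^ 2) * (1 + A ^ 2) * e := by
    have : 24 * (1 + A) ≤ 36 * (1 + A ^ 2) := by nlinarith [sq_nonneg (A - 1)]
    calc 24 * (x ^ 2 * θ ^ 2) * (1 + A) = (x ^ 2 * θ ^ 2) * (24 * (1 + A)) := by ring
      _ ≤ (x ^ 2 * θ ^ 2) * (36 * (1 + A ^ 2)) := by gcongr
      _ ≤ (x ^ 2 * θ ^ 2) * (36 * (1 + A ^ 2)) * e := le_mul_of_one_le_right (by positivity) h5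
      _ = _ := by ring
  have h8 : 0 ≤ x ^ 2 * θ ^ 2 * e := by positivity
  have h9 : Complex.exp (alphaDiff S x θ) - (1 + alphaDiff S x θ) +
      (alphaDiff S x θ + θ * (x * A : ℝ) * Complex.I) =
      Complex.exp (alphaDiff S x θ) - 1 + θ * (x * A : ℝ) * Complex.I := by ring
  rw [h9] at h6
  nlinarith

/-! ### Decay of the saddle integrand -/

/-- The integrand `exp (e ^ w - e ^ x - i x e ^ x θ)` with `w = x * exp (i θ)`, centred at the
saddle point. -/
def saddleExponent (x θ : ℝ) : ℂ :=
  Real.exp x * (Complex.exp (x * (Complex.exp (θ * Complex.I) - 1)) - 1 - x * θ * Complex.I)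

/-- The exponential of `saddleExponent`. -/
def saddle (x θ : ℝ) : ℂ := Complex.exp (saddleExponent x θ)

theorem continuous_saddle (x : ℝ) : Continuous (saddle x) := by
  unfold saddle saddleExponent
  fun_prop

theorem re_saddleExponent (x θ : ℝ) : (saddleExponent x θ).re =
    Real.exp x * (Real.exp (x * (Real.cos θ - 1)) * Real.cos (x * Real.sin θ) - 1) := by
  have h1 : ((x : ℂ) * (Complex.exp (θ * Complex.I) - 1)).re = x * (Real.cos θ - 1) := by
    rw [Complex.re_ofReal_mul, Complex.sub_re, Complex.exp_ofReal_mul_I_re, Complex.one_re]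
  have h2 : ((x : ℂ) * (Complex.exp (θ * Complex.I) - 1)).im = x * Real.sin θ := by
    rw [Complex.im_ofReal_mul, Complex.sub_im, Complex.exp_ofReal_mul_I_im, Complex.one_im,
      sub_zero]
  have h3 : ((x : ℂ) * θ * Complex.I).re = 0 := by simp
  rw [saddleExponent, Complex.re_ofReal_mul, Complex.sub_re, Complex.sub_re, Complex.exp_re, h1,
    h2, h3, Complex.one_re, sub_zero]

theorem pi_sq_le_ten : Real.pi ^ 2 ≤ 10 := by
  nlinarith [Real.pi_gt_three, Real.pi_lt_d2]

theorem cos_le_one_sub_sq_div_five {t : ℝ} (ht : |t| ≤ Real.pi) :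
    Real.cos t ≤ 1 - t ^ 2 / 5 := by
  have h := Real.cos_le_one_sub_mul_cos_sq ht
  have h1 : (1 : ℝ) / 5 ≤ 2 / Real.pi ^ 2 := by
    rw [div_le_div_iff₀ (by norm_num) (by positivity)]
    linarith [pi_sq_le_ten]
  nlinarith [sq_nonneg t]

theorem sq_le_sin_sq {t : ℝ} (ht : |t| ≤ Real.pi / 2) : 2 / 5 * t ^ 2 ≤ Real.sin t ^ 2 := by
  have h := pow_le_pow_left₀ (by positivity) (Real.mul_abs_le_abs_sin ht) 2
  rw [mul_pow, sq_abs, sq_abs, div_pow] at h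
  have h1 : (2 : ℝ) / 5 ≤ 2 ^ 2 / Real.pi ^ 2 := by
    rw [div_le_div_iff₀ (by norm_num) (by positivity)]
    linarith [pi_sq_le_ten]
  nlinarith [sq_nonneg t]

/-- Near the peak the decay comes from the factor cos(x sin θ) ≤ 1 - (2/25)(xθ)². -/
theorem re_saddleExponent_le_of_mul_le {x θ : ℝ} (hx : 1 ≤ x) (h : x * |θ| ≤ 1) :
    (saddleExponent x θ).re ≤ -(Real.exp x * (x * |θ|) ^ 2 / 16) := by
  have hx0 : 0 ≤ x := by linarith
  have hθ : |θ| ≤ 1 := by nlinarith [abs_nonneg θ]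
  have hpi := Real.pi_gt_three
  have h1 : |x * Real.sin θ| ≤ 1 := by
    rw [abs_mul, abs_of_nonneg hx0]
    have : |Real.sin θ| ≤ |θ| := Real.abs_sin_le_abs
    nlinarith
  have h2 := cos_le_one_sub_sq_div_five (t := x * Real.sin θ) (by linarith)
  have h3 := sq_le_sin_sq (t := θ) (by linarith)
  have h4 : 0 ≤ Real.cos (x * Real.sin θ) :=
    Real.cos_nonneg_of_mem_Icc ⟨by linarith [(abs_le.1 h1).1], by linarith [(abs_le.1 h1).2]⟩
  have h5 : Real.exp (x * (Real.cos θ - 1)) ≤ 1 :=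
    Real.exp_le_one_iff.2 (mul_nonpos_of_nonneg_of_nonpos hx0
      (by linarith [Real.cos_le_one θ]))
  have h6 := mul_le_of_le_one_left h4 h5
  rw [mul_pow] at h2
  have h7 := mul_le_mul_of_nonneg_left h3 (sq_nonneg x)
  have h8 : Real.exp (x * (Real.cos θ - 1)) * Real.cos (x * Real.sin θ) - 1 ≤
      -((x * |θ|) ^ 2 / 16) := by
    rw [mul_pow, sq_abs]
    nlinarith [mul_nonneg (sq_nonneg x) (sq_nonneg θ)]
  rw [re_saddleExponent]
  have := mul_le_mul_of_nonneg_left h8 (Real.exp_pos x).le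
  linarith

/-- Away from the peak the oscillating cosine is bounded by 1, and the decay comes from exp(x(cos θ
- 1)) ≤ e^(-y) with y = 1/(5x). -/
theorem re_saddleExponent_le_of_le_mul {x θ : ℝ} (hx : 1 ≤ x) (h : 1 ≤ x * |θ|)
    (hθ : |θ| ≤ Real.pi) : (saddleExponent x θ).re ≤ -(Real.exp x / (10 * x)) := by
  have hx0 : 0 < x := by linarith
  have h1 := cos_le_one_sub_sq_div_five hθ
  have h2 : x * (Real.cos θ - 1) ≤ -(1 / (5 * x)) := by
    have h3 : 1 ≤ x ^ 2 * θ ^ 2 := by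
      rw [← sq_abs θ, ← mul_pow]
      exact one_le_pow₀ h
    have h4 : 1 / (5 * x) ≤ x * (θ ^ 2 / 5) := by
      rw [div_le_iff₀ (by positivity)]
      nlinarith
    nlinarith
  set y := 1 / (5 * x) with hy
  have hy0 : 0 < y := by positivity
  have hy1 : y ≤ 1 := by
    rw [hy, div_le_one (by positivity)]
    linarith
  have h3 : Real.exp (-y) ≤ 1 - y / 2 := by
    rw [Real.exp_neg]
    have h4 : (1 + y)⁻¹ ≤ 1 - y / 2 := by
      rw [inv_le_iff_one_le_mul₀ (by positivity)]
      nlinarith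
    refine le_trans ?_ h4
    gcongr
    linarith [Real.add_one_le_exp y]
  have h4 : Real.exp (x * (Real.cos θ - 1)) * Real.cos (x * Real.sin θ) ≤ 1 - y / 2 := by
    calc _ ≤ Real.exp (x * (Real.cos θ - 1)) * 1 := by
          gcongr
          exact Real.cos_le_one _
      _ ≤ Real.exp (-y) := by rw [mul_one]; gcongr
      _ ≤ _ := h3
  rw [re_saddleExponent]
  have h5 : Real.exp x / (10 * x) = Real.exp x * (y / 2) := by
    rw [hy]
    field_simp
    norm_num
  rw [h5]
  have := mul_le_mul_of_nonneg_left h4 (Real.exp_pos x).le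
  linarith

theorem norm_saddle (x θ : ℝ) : ‖saddle x θ‖ = Real.exp (saddleExponent x θ).re :=
  Complex.norm_exp _

/-! ### Second-order remainders against the saddle -/

/-- The exponential dominates `x ^ 2 * exp (κ x)` when `κ < 1`. -/
theorem exists_sq_mul_exp_le {κ : ℝ} (hκ : κ < 1) (C : ℝ) :
    ∃ x₀ : ℝ, 1 ≤ x₀ ∧ ∀ x, x₀ ≤ x → C * (x ^ 2 * Real.exp (κ * x)) ≤ Real.exp x := by
  have hκ' : 0 < 1 - κ := by linarith
  refine ⟨max 1 (6 * C / (1 - κ) ^ 3), le_max_left _ _, fun x hx => ?_⟩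
  have hx1 : 1 ≤ x := (le_max_left _ _).trans hx
  have hx2 : 6 * C ≤ x * (1 - κ) ^ 3 := by
    rw [← div_le_iff₀ (by positivity)]
    exact (le_max_right _ _).trans hx
  have h := Real.pow_div_factorial_le_exp (x := (1 - κ) * x) (by positivity) 3
  have h1 : C * x ^ 2 ≤ Real.exp ((1 - κ) * x) := by
    refine le_trans ?_ h
    norm_num [Nat.factorial]
    nlinarith [mul_le_mul_of_nonneg_right hx2 (sq_nonneg x)]
  calc C * (x ^ 2 * Real.exp (κ * x)) = C * x ^ 2 * Real.exp (κ * x) := by ring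
    _ ≤ Real.exp ((1 - κ) * x) * Real.exp (κ * x) := by gcongr
    _ = Real.exp x := by rw [← Real.exp_add]; ring_nf

/-- This is where κ ≤ 1/2 is needed. With y = x|θ|, Ay ≤ e^x y²/32 + 8A²e^(-x), whose last term is
at most 8D², and y² costs e^x y²/64. Of the decay rate 1/16 there remains 1/16 - 1/32 - 1/64 = 1/64.
-/
theorem saddle_bound_of_mul_le {x θ A D κ : ℝ} (hx : 1 ≤ x) (hκ : κ ≤ 1 / 2) (hA : 0 ≤ A)
    (hAD : A ≤ D * Real.exp (κ * x)) (h : x * |θ| ≤ 1) :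
    ‖saddle x θ‖ * (x ^ 2 * θ ^ 2 * Real.exp (A * (x * |θ|))) ≤
      64 * Real.exp (8 * D ^ 2) * Real.exp (-x) *
        Real.exp (-(x ^ 2 * Real.exp x / 64) * θ ^ 2) := by
  have hA2 : A ^ 2 * Real.exp (-x) ≤ D ^ 2 := by
    have h1 := pow_le_pow_left₀ hA hAD 2
    have h2 : Real.exp (κ * x) ^ 2 * Real.exp (-x) ≤ 1 := by
      rw [← Real.exp_nat_mul, ← Real.exp_add, Real.exp_le_one_iff]
      push_cast
      nlinarith
    calc A ^ 2 * Real.exp (-x) ≤ (D * Real.exp (κ * x)) ^ 2 * Real.exp (-x) := by gcongr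
      _ = D ^ 2 * (Real.exp (κ * x) ^ 2 * Real.exp (-x)) := by ring
      _ ≤ D ^ 2 := mul_le_of_le_one_right (sq_nonneg D) h2
  have h1 := re_saddleExponent_le_of_mul_le hx h
  have he : Real.exp x * Real.exp (-x) = 1 := by rw [← Real.exp_add]; simp
  have hsq : x ^ 2 * θ ^ 2 = (x * |θ|) ^ 2 := by rw [mul_pow, sq_abs]
  have hsq' : -(x ^ 2 * Real.exp x / 64) * θ ^ 2 = -(Real.exp x * (x * |θ|) ^ 2 / 64) := by
    rw [← hsq]; ring
  rw [norm_saddle, hsq', hsq]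
  set y := x * |θ|
  set p := Real.exp x
  have hp : 0 < p := Real.exp_pos x
  have h2 : A * y ≤ p * y ^ 2 / 32 + 8 * (A ^ 2 * Real.exp (-x)) := by
    have h3 : 0 ≤ Real.exp (-x) * (p * y - 16 * A) ^ 2 := by positivity
    have h4 : Real.exp (-x) * (p * y - 16 * A) ^ 2 = (p * Real.exp (-x)) * (p * y ^ 2) -
      32 * (p * Real.exp (-x)) * (A * y) + 256 * (A ^ 2 * Real.exp (-x)) := by ring
    rw [h4, he] at h3
    linarith
  have h3 : y ^ 2 ≤ 64 * Real.exp (-x) * Real.exp (p * y ^ 2 / 64) := by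
    have h4 := Real.add_one_le_exp (p * y ^ 2 / 64)
    have h5 : y ^ 2 = 64 * Real.exp (-x) * (p * y ^ 2 / 64) := by
      linear_combination (-(y ^ 2)) * he
    calc y ^ 2 = 64 * Real.exp (-x) * (p * y ^ 2 / 64) := h5
      _ ≤ _ := by gcongr; linarith
  calc Real.exp (saddleExponent x θ).re * (y ^ 2 * Real.exp (A * y))
      ≤ Real.exp (-(p * y ^ 2 / 16)) * ((64 * Real.exp (-x) * Real.exp (p * y ^ 2 / 64)) *
        Real.exp (p * y ^ 2 / 32 + 8 * D ^ 2)) := by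
        gcongr
        linarith
    _ = 64 * Real.exp (-x) * Real.exp (-(p * y ^ 2 / 16) + p * y ^ 2 / 64 +
        (p * y ^ 2 / 32 + 8 * D ^ 2)) := by
        rw [Real.exp_add _ (p * y ^ 2 / 32 + _), Real.exp_add (-(p * y ^ 2 / 16))]; ring
    _ = 64 * Real.exp (-x) * Real.exp (8 * D ^ 2 + -(p * y ^ 2 / 64)) := by
        congr 2; ring
    _ = _ := by rw [Real.exp_add]; ring

/-- The decay exp(-e^x/(10x)) beats both y² ≤ e^(8x) and exp(4Dx e^(κx)). -/
theorem saddle_bound_of_le_mul {x θ A D κ : ℝ} (hx : 1 ≤ x) (hκ : 0 ≤ κ)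
    (hAD : A ≤ D * Real.exp (κ * x)) (hD : 0 ≤ D)
    (hlarge : 10 * (12 + 4 * D) * (x ^ 2 * Real.exp (κ * x)) ≤ Real.exp x)
    (h : 1 ≤ x * |θ|) (hθ : |θ| ≤ Real.pi) :
    ‖saddle x θ‖ * (x ^ 2 * θ ^ 2 * Real.exp (A * (x * |θ|))) ≤ Real.exp (-(2 * x)) := by
  have hx0 : 0 < x := by linarith
  have h1 := re_saddleExponent_le_of_le_mul hx h hθ
  have hpi : Real.pi < 4 := Real.pi_lt_d2.trans (by norm_num)
  have hsq : x ^ 2 * θ ^ 2 = (x * |θ|) ^ 2 := by rw [mul_pow, sq_abs]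
  have hy : x * |θ| ≤ 4 * x := by nlinarith [abs_nonneg θ]
  rw [norm_saddle, hsq]
  set y := x * |θ|
  have hy0 : 0 ≤ y := by linarith
  have h2 : y ^ 2 ≤ Real.exp (8 * x) := by
    have : y ≤ Real.exp (4 * x) := by linarith [Real.add_one_le_exp (4 * x)]
    calc y ^ 2 ≤ Real.exp (4 * x) ^ 2 := by gcongr
      _ = Real.exp (8 * x) := by rw [← Real.exp_nat_mul]; push_cast; ring_nf
  have h3 : A * y ≤ D * Real.exp (κ * x) * (4 * x) :=
    mul_le_mul hAD hy hy0 (by positivity)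
  have h4 : 10 * x + D * Real.exp (κ * x) * (4 * x) ≤ Real.exp x / (10 * x) := by
    rw [le_div_iff₀ (by positivity)]
    refine le_trans ?_ hlarge
    have h5 : 1 ≤ Real.exp (κ * x) := Real.one_le_exp (by positivity)
    nlinarith [mul_le_mul_of_nonneg_left h5 (sq_nonneg x)]
  calc Real.exp (saddleExponent x θ).re * (y ^ 2 * Real.exp (A * y))
      ≤ Real.exp (-(Real.exp x / (10 * x))) * (Real.exp (8 * x) *
        Real.exp (D * Real.exp (κ * x) * (4 * x))) := by gcongr
    _ = Real.exp (-(Real.exp x / (10 * x)) + (8 * x + D * Real.exp (κ * x) * (4 * x))) := by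
        rw [Real.exp_add, Real.exp_add]
    _ ≤ Real.exp (-(2 * x)) := by
        gcongr
        linarith

theorem norm_integral_le_gaussian {f : ℝ → ℂ} {a b c : ℝ} (hb : 0 < b) (ha : 0 ≤ a)
    (hf : ∀ θ : ℝ, |θ| ≤ Real.pi → ‖f θ‖ ≤ a * Real.exp (-b * θ ^ 2) + c) :
    ‖∫ θ in -Real.pi..Real.pi, f θ‖ ≤ a * √(Real.pi / b) + 2 * Real.pi * c := by
  have hpi := Real.pi_pos
  have hint : MeasureTheory.Integrable fun θ : ℝ => a * Real.exp (-b * θ ^ 2) :=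
    (integrable_exp_neg_mul_sq hb).const_mul a
  have h1 : ‖∫ θ in -Real.pi..Real.pi, f θ‖ ≤
      ∫ θ in -Real.pi..Real.pi, (a * Real.exp (-b * θ ^ 2) + c) := by
    refine intervalIntegral.norm_integral_le_of_norm_le (by linarith)
      (.of_forall fun θ hθ => hf θ (abs_le.2 ⟨hθ.1.le, hθ.2⟩)) ?_
    exact (by fun_prop : Continuous fun θ : ℝ => a * Real.exp (-b * θ ^ 2) + c).intervalIntegrable
      _ _
  refine h1.trans ?_
  rw [intervalIntegral.integral_add hint.intervalIntegrable (by simp),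
    intervalIntegral.integral_const, intervalIntegral.integral_of_le (by linarith)]
  have h2 : ∫ θ in Set.Ioc (-Real.pi) Real.pi, a * Real.exp (-b * θ ^ 2) ≤
      ∫ θ : ℝ, a * Real.exp (-b * θ ^ 2) :=
    MeasureTheory.setIntegral_le_integral hint (.of_forall fun θ => by positivity)
  have h3 : ∫ θ : ℝ, a * Real.exp (-b * θ ^ 2) = a * √(Real.pi / b) := by
    rw [MeasureTheory.integral_const_mul, integral_gaussian]
  rw [h3] at h2
  rw [smul_eq_mul]
  linarith

/-- The width factor `x * exp (x / 2)` of the saddle point. -/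
def scale (x : ℝ) : ℝ := x * Real.exp (x / 2)

theorem scale_pos {x : ℝ} (hx : 0 < x) : 0 < scale x := mul_pos hx (Real.exp_pos _)

theorem scale_sq (x : ℝ) : scale x ^ 2 = x ^ 2 * Real.exp x := by
  rw [scale, mul_pow, ← Real.exp_nat_mul]
  ring_nf

theorem sqrt_pi_div_scale {x k : ℝ} (hx : 0 < x) :
    √(Real.pi / (x ^ 2 * Real.exp x / k)) = √(Real.pi * k) / scale x := by
  rw [← scale_sq, div_div_eq_mul_div, Real.sqrt_div' _ (sq_nonneg _),
    Real.sqrt_sq (scale_pos hx).le]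

theorem exp_neg_two_mul_le {x : ℝ} (hx : 0 < x) :
    Real.exp (-(2 * x)) ≤ 2 * (Real.exp (-x) / scale x) := by
  rw [mul_div_assoc', le_div_iff₀ (scale_pos hx), scale]
  have h1 : x ≤ 2 * Real.exp (x / 2) := by linarith [Real.add_one_le_exp (x / 2)]
  have h2 : Real.exp (-x) = Real.exp (-(2 * x)) * (Real.exp (x / 2) * Real.exp (x / 2)) := by
    rw [← Real.exp_add, ← Real.exp_add]; ring_nf
  rw [h2]
  nlinarith [mul_le_mul_of_nonneg_left h1
    (mul_pos (Real.exp_pos (-(2 * x))) (Real.exp_pos (x / 2))).le]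

/-- On a peak of width 1/`scale x`, the weight x²θ² has size x²/`scale x`² = e^(-x). -/
theorem exists_norm_integral_saddle_mul_le {κ D : ℝ} (hκ₀ : 0 ≤ κ) (hκ : κ < 1 / 2)
    (hD : 0 ≤ D) : ∃ x₀ K : ℝ, 1 ≤ x₀ ∧ 0 < K ∧ ∀ x A : ℝ, x₀ ≤ x → 0 ≤ A →
      A ≤ D * Real.exp (κ * x) → ∀ (M : ℝ) (f : ℝ → ℂ), 0 ≤ M →
      (∀ θ, ‖f θ‖ ≤ M * (x ^ 2 * θ ^ 2 * Real.exp (A * (x * |θ|)))) →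
      ‖∫ θ in -Real.pi..Real.pi, saddle x θ * f θ‖ ≤ K * M * (Real.exp (-x) / scale x) := by
  obtain ⟨x₀, hx₀, hlarge⟩ := exists_sq_mul_exp_le (by linarith : κ < 1) (10 * (12 + 4 * D))
  have hpi := Real.pi_pos
  refine ⟨x₀, 64 * Real.exp (8 * D ^ 2) * √(Real.pi * 64) + 4 * Real.pi, hx₀, by positivity,
    fun x A hx hA hAD M f hM hf => ?_⟩
  have hx1 : 1 ≤ x := hx₀.trans hx
  have hx0 : 0 < x := by linarith
  have h := norm_integral_le_gaussian (f := fun θ => saddle x θ * f θ)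
    (a := M * (64 * Real.exp (8 * D ^ 2) * Real.exp (-x))) (b := x ^ 2 * Real.exp x / 64)
    (c := M * Real.exp (-(2 * x))) (by positivity) (by positivity) (fun θ hθ => ?_)
  · refine h.trans ?_
    rw [sqrt_pi_div_scale hx0]
    have h1 := mul_le_mul_of_nonneg_left (exp_neg_two_mul_le hx0)
      (by positivity : 0 ≤ 2 * Real.pi * M)
    have h2 : M * (64 * Real.exp (8 * D ^ 2) * Real.exp (-x)) * (√(Real.pi * 64) / scale x) =
      64 * Real.exp (8 * D ^ 2) * √(Real.pi * 64) * M * (Real.exp (-x) / scale x) := by ring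
    rw [h2]
    linarith
  · have h1 : ‖saddle x θ * f θ‖ ≤
        M * (‖saddle x θ‖ * (x ^ 2 * θ ^ 2 * Real.exp (A * (x * |θ|)))) := by
      rw [norm_mul]
      calc _ ≤ ‖saddle x θ‖ * (M * (x ^ 2 * θ ^ 2 * Real.exp (A * (x * |θ|)))) := by
            gcongr
            exact hf θ
        _ = _ := by ring
    refine h1.trans ?_
    rw [mul_assoc M, ← mul_add]
    gcongr
    rcases le_total (x * |θ|) 1 with h2 | h2
    · have := saddle_bound_of_mul_le hx1 hκ.le hA hAD h2
      have := Real.exp_pos (-(2 * x))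
      linarith
    · have := saddle_bound_of_le_mul hx1 hκ₀ hAD hD (hlarge x hx) h2 hθ
      have : 0 ≤ 64 * Real.exp (8 * D ^ 2) * Real.exp (-x) *
        Real.exp (-(x ^ 2 * Real.exp x / 64) * θ ^ 2) := by positivity
      linarith

/-! ### Gaussian approximation and a lower bound for the denominator -/

theorem norm_cexp_sub_cexp_le {a b : ℂ} {M : ℝ} (ha : a.re ≤ M) (hb : b.re ≤ M) :
    ‖Complex.exp a - Complex.exp b‖ ≤ Real.exp M * ‖a - b‖ := by
  refine (convex_halfSpace_re_le M).norm_image_sub_le_of_norm_hasDerivWithin_le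
    (fun z _ => (Complex.hasDerivAt_exp z).hasDerivWithinAt) (fun z hz => ?_) hb ha
  rw [Complex.norm_exp]
  exact Real.exp_le_exp.2 hz

theorem norm_cexp_sub_quadratic_le {z : ℂ} (hz : ‖z‖ ≤ 1) :
    ‖Complex.exp z - 1 - z - z ^ 2 / 2‖ ≤ 3 * ‖z‖ ^ 3 := by
  have h := Complex.norm_exp_sub_sum_le_norm_mul_exp z 3
  simp only [sum_range_succ, range_zero, sum_empty, pow_zero, Nat.factorial_zero, Nat.cast_one,
    div_one, zero_add, pow_one, Nat.factorial_one, Nat.factorial_two, Nat.cast_ofNat] at h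
  rw [show Complex.exp z - 1 - z - z ^ 2 / 2 = Complex.exp z - (1 + z + z ^ 2 / 2) by ring]
  have h1 : Real.exp ‖z‖ ≤ 3 :=
    (Real.exp_le_exp.2 hz).trans (Real.exp_one_lt_d9.le.trans (by norm_num))
  nlinarith [pow_nonneg (norm_nonneg z) 3]

/-- Half the second derivative at `0` of `-saddleExponent x`: near `0`, the function `saddle x` is
close to `exp (-halfVariance x * θ ^ 2)`. -/
def halfVariance (x : ℝ) : ℝ := Real.exp x * (x * (1 + x)) / 2

/-- With w = iθ and u = x(e^w - 1), the difference splits into the cubic remainders of e^u and of x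
e^w, and (u² - x²w²)/2; each is at most 3(x|θ|)³. -/
theorem norm_saddleExponent_add_le {x θ : ℝ} (hx : 1 ≤ x) (h : x * |θ| ≤ 1) :
    ‖saddleExponent x θ - ((-halfVariance x * θ ^ 2 : ℝ) : ℂ)‖ ≤
      9 * (Real.exp x * (x * |θ|) ^ 3) := by
  have hx0 : 0 ≤ x := by linarith
  have hθ : |θ| ≤ 1 := by nlinarith [abs_nonneg θ]
  have hI : ‖(θ : ℂ) * Complex.I‖ = |θ| := by simp
  have hnx : ‖(x : ℂ)‖ = x := by rw [Complex.norm_real, Real.norm_of_nonneg hx0]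
  set w : ℂ := θ * Complex.I with hw
  have hw2 : w ^ 2 = -(θ : ℂ) ^ 2 := by rw [hw, mul_pow, Complex.I_sq]; ring
  set u : ℂ := x * (Complex.exp w - 1) with hu
  have hun : ‖u‖ ≤ x * |θ| := by
    rw [hu, norm_mul, hnx]
    have := Real.norm_exp_I_mul_ofReal_sub_one_le (x := θ)
    rw [mul_comm Complex.I, Real.norm_eq_abs] at this
    gcongr
  have h1 : ‖Complex.exp u - 1 - u - u ^ 2 / 2‖ ≤ 3 * (x * |θ|) ^ 3 :=
    (norm_cexp_sub_quadratic_le (hun.trans h)).trans (by gcongr)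
  have h2 : ‖(x : ℂ) * (Complex.exp w - 1 - w - w ^ 2 / 2)‖ ≤ 3 * (x * |θ|) ^ 3 := by
    rw [norm_mul, hnx]
    have h3 := norm_cexp_sub_quadratic_le (z := w) (by rwa [hI])
    rw [hI] at h3
    calc x * ‖Complex.exp w - 1 - w - w ^ 2 / 2‖ ≤ x * (3 * |θ| ^ 3) := by gcongr
      _ ≤ x ^ 3 * (3 * |θ| ^ 3) := by
        gcongr
        exact le_self_pow₀ hx (by norm_num)
      _ = _ := by ring
  have h3 : ‖(u - x * w) * (u + x * w) / 2‖ ≤ 3 * (x * |θ|) ^ 3 := by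
    have h4 : ‖u - x * w‖ ≤ x * (3 * θ ^ 2) := by
      rw [show u - x * w = x * (Complex.exp w - 1 - w) by rw [hu]; ring, norm_mul, hnx]
      gcongr
      exact norm_exp_mul_I_sub_le θ
    have h5 : ‖u + x * w‖ ≤ 2 * (x * |θ|) := by
      refine (norm_add_le _ _).trans ?_
      rw [norm_mul (x : ℂ) w, hnx, hI]
      linarith
    rw [norm_div, norm_mul, Complex.norm_ofNat]
    calc ‖u - x * w‖ * ‖u + x * w‖ / 2 ≤ x * (3 * θ ^ 2) * (2 * (x * |θ|)) / 2 := by gcongr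
      _ = 3 * (x ^ 2 * |θ| ^ 3) := by rw [← sq_abs θ]; ring
      _ ≤ 3 * (x ^ 3 * |θ| ^ 3) := by
        gcongr
        norm_num
      _ = _ := by ring
  have h4 : saddleExponent x θ - ((-halfVariance x * θ ^ 2 : ℝ) : ℂ) =
      Real.exp x * ((Complex.exp u - 1 - u - u ^ 2 / 2) +
        x * (Complex.exp w - 1 - w - w ^ 2 / 2) + (u - x * w) * (u + x * w) / 2) := by
    have h5 : (u - x * w) * (u + x * w) = u ^ 2 - x ^ 2 * w ^ 2 := by ring
    rw [h5, hw2, saddleExponent, halfVariance]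
    push_cast
    rw [mul_assoc (x : ℂ) θ Complex.I, ← hw, ← hu, hu]
    ring
  rw [h4, norm_mul, Complex.norm_real, Real.norm_of_nonneg (Real.exp_pos x).le]
  have h5 := norm_add₃_le (a := Complex.exp u - 1 - u - u ^ 2 / 2)
    (b := x * (Complex.exp w - 1 - w - w ^ 2 / 2)) (c := (u - x * w) * (u + x * w) / 2)
  calc _ ≤ Real.exp x * (9 * (x * |θ|) ^ 3) := by gcongr; linarith
    _ = _ := by ring

theorem cube_le_exp_sq (v : ℝ) : v ^ 3 ≤ 2049 * Real.exp (v ^ 2 / 32) := by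
  -- The quadratic term is v⁴/2048, which explains 2049.
  have h := Real.quadratic_le_exp_of_nonneg (x := v ^ 2 / 32) (by positivity)
  nlinarith [sq_nonneg (v ^ 2 - v), sq_nonneg v]

theorem norm_saddle_sub_le_of_mul_le {x θ : ℝ} (hx : 1 ≤ x) (h : x * |θ| ≤ 1) :
    ‖saddle x θ - (Real.exp (-halfVariance x * θ ^ 2) : ℂ)‖ ≤
      9 * 2049 * Real.exp (-(x / 2)) * Real.exp (-(x ^ 2 * Real.exp x / 32) * θ ^ 2) := by
  have h1 := re_saddleExponent_le_of_mul_le hx h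
  have hsq : x ^ 2 * θ ^ 2 = (x * |θ|) ^ 2 := by rw [mul_pow, sq_abs]
  have hsq' : -(x ^ 2 * Real.exp x / 32) * θ ^ 2 = -(Real.exp x * (x * |θ|) ^ 2 / 32) := by
    rw [← hsq]; ring
  have h2 : ((-halfVariance x * θ ^ 2 : ℝ) : ℂ).re ≤ -(Real.exp x * (x * |θ|) ^ 2 / 16) := by
    rw [Complex.ofReal_re, halfVariance, ← hsq]
    have : 0 ≤ Real.exp x * θ ^ 2 * x ^ 2 := by positivity
    have : 0 ≤ Real.exp x * θ ^ 2 * x := by positivity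
    nlinarith
  have h3 := norm_cexp_sub_cexp_le h1 h2
  have h4 := norm_saddleExponent_add_le hx h
  rw [saddle, Complex.ofReal_exp, hsq']
  refine h3.trans ?_
  set y := x * |θ| with hy
  have hy0 : 0 ≤ y := by positivity
  have h5 := cube_le_exp_sq (Real.exp (x / 2) * y)
  have h6 : (Real.exp (x / 2) * y) ^ 2 = Real.exp x * y ^ 2 := by
    rw [mul_pow, ← Real.exp_nat_mul]; ring_nf
  have h7 : Real.exp x * y ^ 3 = Real.exp (-(x / 2)) * (Real.exp (x / 2) * y) ^ 3 := by
    rw [mul_pow (Real.exp _), ← Real.exp_nat_mul, ← mul_assoc, ← Real.exp_add]; ring_nf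
  rw [h6] at h5
  calc _ ≤ Real.exp (-(Real.exp x * y ^ 2 / 16)) * (9 * (Real.exp x * y ^ 3)) := by gcongr
    _ ≤ Real.exp (-(Real.exp x * y ^ 2 / 16)) * (9 * (Real.exp (-(x / 2)) *
        (2049 * Real.exp (Real.exp x * y ^ 2 / 32)))) := by rw [h7]; gcongr
    _ = 9 * 2049 * Real.exp (-(x / 2)) *
        Real.exp (-(Real.exp x * y ^ 2 / 16) + Real.exp x * y ^ 2 / 32) := by
        rw [Real.exp_add]; ring
    _ = _ := by congr 2; ring

theorem norm_saddle_sub_le_of_le_mul {x θ : ℝ} (hx : 1 ≤ x) (h : 1 ≤ x * |θ|)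
    (hθ : |θ| ≤ Real.pi) (hlarge : 20 * x ^ 2 ≤ Real.exp x) :
    ‖saddle x θ - (Real.exp (-halfVariance x * θ ^ 2) : ℂ)‖ ≤ 2 * Real.exp (-(2 * x)) := by
  have hx0 : 0 < x := by linarith
  have h1 := re_saddleExponent_le_of_le_mul hx h hθ
  have h2 : 2 * x ≤ Real.exp x / (10 * x) := by
    rw [le_div_iff₀ (by positivity)]
    linarith
  have h3 : 2 * x ≤ halfVariance x * θ ^ 2 := by
    have hsq : x ^ 2 * θ ^ 2 = (x * |θ|) ^ 2 := by rw [mul_pow, sq_abs]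
    have h4 : 1 ≤ x ^ 2 * θ ^ 2 := by rw [hsq]; exact one_le_pow₀ h
    have h5 : halfVariance x * θ ^ 2 =
        Real.exp x * (x ^ 2 * θ ^ 2) / 2 + Real.exp x * (x * θ ^ 2) / 2 := by
      rw [halfVariance]; ring
    have h6 : 0 ≤ Real.exp x * (x * θ ^ 2) / 2 := by positivity
    have h7 := le_mul_of_one_le_right (Real.exp_pos x).le h4
    rw [h5]
    nlinarith
  refine (norm_sub_le _ _).trans ?_
  rw [norm_saddle, Complex.norm_real, Real.norm_of_nonneg (Real.exp_pos _).le, two_mul]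
  gcongr <;> linarith

/-- For |θ| ≤ 1/`scale x` the integrand is at least e^(-1) ≥ 1/3. -/
theorem le_integral_gaussian {x : ℝ} (hx : 1 ≤ x) :
    2 / 3 / scale x ≤ ∫ θ in -Real.pi..Real.pi, Real.exp (-halfVariance x * θ ^ 2) := by
  have hx0 : 0 < x := by linarith
  have hs := scale_pos hx0
  have hs1 : 1 ≤ scale x := one_le_mul_of_one_le_of_one_le hx (Real.one_le_exp (by linarith))
  have hpi := Real.pi_gt_three
  have hc : Continuous fun θ : ℝ => Real.exp (-halfVariance x * θ ^ 2) := by fun_prop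
  have hinv : 1 / scale x ≤ 1 := by rw [div_le_one hs]; exact hs1
  have hinv0 : 0 < 1 / scale x := by positivity
  have h1 : ∫ θ in -(1 / scale x)..(1 / scale x), Real.exp (-halfVariance x * θ ^ 2) ≤
      ∫ θ in -Real.pi..Real.pi, Real.exp (-halfVariance x * θ ^ 2) :=
    intervalIntegral.integral_mono_interval (by linarith) (by linarith) (by linarith)
      (.of_forall fun θ => (Real.exp_pos _).le) (hc.intervalIntegrable _ _)
  refine le_trans ?_ h1
  have h2 : ∫ _θ in -(1 / scale x)..(1 / scale x), Real.exp (-1) ≤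
      ∫ θ in -(1 / scale x)..(1 / scale x), Real.exp (-halfVariance x * θ ^ 2) := by
    refine intervalIntegral.integral_mono_on (by linarith) (by simp)
      (hc.intervalIntegrable _ _) fun θ hθ => Real.exp_le_exp.2 ?_
    have h3 : θ ^ 2 ≤ (1 / scale x) ^ 2 := sq_le_sq' hθ.1 hθ.2
    have h4 : halfVariance x ≤ scale x ^ 2 := by
      rw [scale_sq, halfVariance]
      nlinarith [Real.exp_pos x, mul_pos (Real.exp_pos x) hx0]
    have h5 : halfVariance x * θ ^ 2 ≤ scale x ^ 2 * (1 / scale x) ^ 2 := by gcongr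
    rw [← mul_pow, mul_one_div_cancel hs.ne', one_pow] at h5
    linarith
  refine le_trans ?_ h2
  rw [intervalIntegral.integral_const, smul_eq_mul]
  have h3 : (1 : ℝ) / 3 ≤ Real.exp (-1) := by
    rw [Real.exp_neg, ← one_div]
    gcongr
    exact Real.exp_one_lt_d9.le.trans (by norm_num)
  calc 2 / 3 / scale x = (1 / scale x - -(1 / scale x)) * (1 / 3) := by ring
    _ ≤ _ := by gcongr; linarith

theorem exists_le_norm_integral_saddle : ∃ x₀ : ℝ, 1 ≤ x₀ ∧ ∀ x, x₀ ≤ x →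
    1 / 3 / scale x ≤ ‖∫ θ in -Real.pi..Real.pi, saddle x θ‖ := by
  obtain ⟨x₁, hx₁, hlarge⟩ := exists_sq_mul_exp_le (by norm_num : (0 : ℝ) < 1) 20
  have hpi := Real.pi_pos
  set K := 9 * 2049 * √(Real.pi * 32) + 8 * Real.pi with hK
  have hK0 : 0 < K := by positivity
  -- For x ≥ 6K, e^(x/2) ≥ x/2 ≥ 3K, so the error K e^(-x/2)/`scale x` is at most half of the
  -- Gaussian lower bound.
  refine ⟨max x₁ (6 * K), hx₁.trans (le_max_left _ _), fun x hx => ?_⟩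
  have hx₁' : x₁ ≤ x := (le_max_left _ _).trans hx
  have hxK : 6 * K ≤ x := (le_max_right _ _).trans hx
  have hx1 : 1 ≤ x := hx₁.trans hx₁'
  have hx0 : 0 < x := by linarith
  have hs := scale_pos hx0
  have hl : 20 * x ^ 2 ≤ Real.exp x := by simpa using hlarge x hx₁'
  have h := norm_integral_le_gaussian
    (f := fun θ => saddle x θ - (Real.exp (-halfVariance x * θ ^ 2) : ℂ))
    (a := 9 * 2049 * Real.exp (-(x / 2))) (b := x ^ 2 * Real.exp x / 32)
    (c := 2 * Real.exp (-(2 * x))) (by positivity) (by positivity) (fun θ hθ => ?_)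
  · rw [sqrt_pi_div_scale hx0, intervalIntegral.integral_sub
      ((continuous_saddle x).intervalIntegrable _ _)
      (Continuous.intervalIntegrable (by fun_prop) _ _), intervalIntegral.integral_ofReal] at h
    have h1 := exp_neg_two_mul_le hx0
    have h2 : Real.exp (-x) ≤ Real.exp (-(x / 2)) := by gcongr; linarith
    have h3 : Real.exp (-(2 * x)) ≤ 2 * (Real.exp (-(x / 2)) / scale x) := by
      refine h1.trans ?_
      gcongr
    have h4 : K * Real.exp (-(x / 2)) ≤ 1 / 3 := by
      rw [Real.exp_neg, ← div_eq_mul_inv, div_le_iff₀ (Real.exp_pos _)]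
      linarith [Real.add_one_le_exp (x / 2)]
    have h5 := le_integral_gaussian hx1
    set J := ∫ θ in -Real.pi..Real.pi, Real.exp (-halfVariance x * θ ^ 2)
    have h6 : J ≤ ‖(J : ℂ)‖ := by
      rw [Complex.norm_real]
      exact le_abs_self J
    have h7 := norm_sub_norm_le (J : ℂ) (∫ θ in -Real.pi..Real.pi, saddle x θ)
    rw [norm_sub_rev] at h7
    have h8 : 9 * 2049 * Real.exp (-(x / 2)) * (√(Real.pi * 32) / scale x) +
        2 * Real.pi * (2 * Real.exp (-(2 * x))) ≤ 1 / 3 / scale x := by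
      calc _ ≤ 9 * 2049 * Real.exp (-(x / 2)) * (√(Real.pi * 32) / scale x) +
            2 * Real.pi * (2 * (2 * (Real.exp (-(x / 2)) / scale x))) := by gcongr
        _ = K * Real.exp (-(x / 2)) / scale x := by rw [hK]; ring
        _ ≤ _ := by gcongr
    have h9 : (2 : ℝ) / 3 / scale x = 1 / 3 / scale x + 1 / 3 / scale x := by ring
    linarith
  · rcases le_total (x * |θ|) 1 with h2 | h2
    · have := norm_saddle_sub_le_of_mul_le hx1 h2
      have := Real.exp_pos (-(2 * x))
      linarith
    · have := norm_saddle_sub_le_of_le_mul hx1 h2 hθ hl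
      have : 0 ≤ 9 * 2049 * Real.exp (-(x / 2)) *
        Real.exp (-(x ^ 2 * Real.exp x / 32) * θ ^ 2) := by positivity
      linarith

/-! ### The first moment of the saddle -/

theorem hasDerivAt_saddle (x θ : ℝ) : HasDerivAt (saddle x)
    (Complex.I * x * Real.exp x * (saddle x θ * (Complex.exp
      (x * (Complex.exp (θ * Complex.I) - 1) + θ * Complex.I) - 1))) θ := by
  have h0 : HasDerivAt (fun t : ℝ => (t : ℂ) * Complex.I) Complex.I θ := by
    simpa using (Complex.ofRealCLM.hasDerivAt (x := θ)).mul_const Complex.I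
  have h1 := ((h0.cexp.sub_const 1).const_mul (x : ℂ)).cexp
  have h2 := (((h1.sub_const 1).sub (h0.const_mul (x : ℂ))).const_mul (Real.exp x : ℂ)).cexp
  have h3 : saddle x = fun t : ℝ => Complex.exp (Real.exp x *
      (Complex.exp (x * (Complex.exp (t * Complex.I) - 1)) - 1 - x * (t * Complex.I))) := by
    funext t
    rw [saddle, saddleExponent, mul_assoc (x : ℂ) t]
  rw [h3]
  refine h2.congr_deriv ?_
  simp only [Pi.sub_apply]
  rw [Complex.exp_add]
  ring

/-- The exponents at ±π differ by 2πi · x e^x up to sign, and x e^x is an integer. -/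
theorem saddle_pi_eq {x : ℝ} {n : ℕ} (hn : x * Real.exp x = n) :
    saddle x Real.pi = saddle x (-Real.pi) := by
  rw [saddle, saddle, Complex.exp_eq_exp_iff_exists_int]
  refine ⟨-n, ?_⟩
  have hn' : (x : ℂ) * Real.exp x = n := by exact_mod_cast hn
  have h1 : Complex.exp (((-Real.pi : ℝ) : ℂ) * Complex.I) = -1 := by
    rw [Complex.ofReal_neg, neg_mul, Complex.exp_neg, Complex.exp_pi_mul_I]
    norm_num
  rw [saddleExponent, saddleExponent, h1, Complex.exp_pi_mul_I]
  push_cast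
  push_cast at hn'
  rw [← hn']
  ring

theorem norm_saddle_deriv_remainder_le {x : ℝ} (hx : 1 ≤ x) (θ : ℝ) :
    ‖Complex.exp (x * (Complex.exp (θ * Complex.I) - 1) + θ * Complex.I) - 1 -
      (1 + x) * θ * Complex.I‖ ≤ 7 * (x ^ 2 * θ ^ 2 * Real.exp (2 * (x * |θ|))) := by
  have hx0 : 0 ≤ x := by linarith
  have hnx : ‖(x : ℂ)‖ = x := by rw [Complex.norm_real, Real.norm_of_nonneg hx0]
  have hI : ‖(θ : ℂ) * Complex.I‖ = |θ| := by simp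
  have h1 := Real.norm_exp_I_mul_ofReal_sub_one_le (x := θ)
  rw [mul_comm Complex.I, Real.norm_eq_abs] at h1
  set w : ℂ := θ * Complex.I with hw
  set v : ℂ := x * (Complex.exp w - 1) + w with hv
  have hvn : ‖v‖ ≤ 2 * (x * |θ|) := by
    refine (norm_add_le _ _).trans ?_
    rw [norm_mul, hnx, hI]
    nlinarith [abs_nonneg θ, mul_le_mul_of_nonneg_left h1 hx0]
  have h2 := Complex.norm_exp_sub_sum_le_norm_mul_exp v 2
  simp only [sum_range_succ, range_zero, sum_empty, pow_zero, Nat.factorial_zero, Nat.cast_one,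
    div_one, zero_add, pow_one, Nat.factorial_one] at h2
  have h3 : ‖v‖ ^ 2 * Real.exp ‖v‖ ≤ (2 * (x * |θ|)) ^ 2 * Real.exp (2 * (x * |θ|)) := by gcongr
  have h4 : ‖(x : ℂ) * (Complex.exp w - 1 - w)‖ ≤ x * (3 * θ ^ 2) := by
    rw [norm_mul, hnx]
    gcongr
    exact norm_exp_mul_I_sub_le θ
  have h5 : x * (3 * θ ^ 2) ≤ 3 * (x ^ 2 * θ ^ 2 * Real.exp (2 * (x * |θ|))) := by
    have h6 : 1 ≤ Real.exp (2 * (x * |θ|)) := Real.one_le_exp (by positivity)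
    calc x * (3 * θ ^ 2) ≤ x ^ 2 * (3 * θ ^ 2) := by
          gcongr
          exact le_self_pow₀ hx (by norm_num)
      _ ≤ x ^ 2 * (3 * θ ^ 2) * Real.exp (2 * (x * |θ|)) :=
          le_mul_of_one_le_right (by positivity) h6
      _ = _ := by ring
  have h6 : (2 * (x * |θ|)) ^ 2 * Real.exp (2 * (x * |θ|)) =
      4 * (x ^ 2 * θ ^ 2 * Real.exp (2 * (x * |θ|))) := by
    rw [mul_pow, mul_pow, sq_abs]; ring
  rw [show Complex.exp v - 1 - (1 + x) * θ * Complex.I =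
    (Complex.exp v - (1 + v)) + x * (Complex.exp w - 1 - w) by rw [hv, hw]; ring]
  refine (norm_add_le _ _).trans ?_
  linarith

/-- The derivative of `saddle x` has integral zero. Up to a constant it is `saddle x` times (1 +
x)iθ plus a second-order remainder, so the first moment inherits the bound for such remainders. -/
theorem integral_saddle_mul_id {x : ℝ} {n : ℕ} (hx : 0 < x) (hn : x * Real.exp x = n) :
    (1 + x) * Complex.I * ∫ θ in -Real.pi..Real.pi, saddle x θ * θ =
      -∫ θ in -Real.pi..Real.pi, saddle x θ *
        (Complex.exp (x * (Complex.exp (θ * Complex.I) - 1) + θ * Complex.I) - 1 -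
          (1 + x) * θ * Complex.I) := by
  have hc := continuous_saddle x
  have h1 : ∫ θ in -Real.pi..Real.pi, Complex.I * x * Real.exp x * (saddle x θ * (Complex.exp
      (x * (Complex.exp (θ * Complex.I) - 1) + θ * Complex.I) - 1)) = 0 := by
    rw [intervalIntegral.integral_eq_sub_of_hasDerivAt (f := saddle x)
      (fun θ _ => hasDerivAt_saddle x θ)
      (Continuous.intervalIntegrable (by fun_prop) _ _), saddle_pi_eq hn, sub_self]
  rw [intervalIntegral.integral_const_mul] at h1
  have hne : Complex.I * x * Real.exp x ≠ 0 := by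
    refine mul_ne_zero (mul_ne_zero Complex.I_ne_zero ?_) ?_
    · exact_mod_cast hx.ne'
    · exact_mod_cast (Real.exp_pos x).ne'
  have h2 := (mul_eq_zero.1 h1).resolve_left hne
  rw [← intervalIntegral.integral_const_mul, eq_neg_iff_add_eq_zero,
    ← intervalIntegral.integral_add (Continuous.intervalIntegrable (by fun_prop) _ _)
      (Continuous.intervalIntegrable (by fun_prop) _ _), ← h2]
  congr 1
  funext θ
  ring

/-! ### The relative error as a quotient of integrals -/

theorem ofReal_alpha (S : Set ℕ) (x : ℝ) : ((alpha S x : ℝ) : ℂ) = egf ℂ (ind S) x := by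
  rw [alpha_eq_egf, egf, egf, Complex.ofReal_tsum]
  refine tsum_congr fun k => ?_
  push_cast
  simp

theorem alphaDiff_empty (x θ : ℝ) : alphaDiff ∅ x θ = 0 := by
  simp [alphaDiff, egf, ind]

theorem alpha_empty (x : ℝ) : alpha ∅ x = 0 := by
  simp [alpha]

theorem continuous_alphaDiff (S : Set ℕ) (x : ℝ) : Continuous (alphaDiff S x) := by
  have := (differentiable_egf (𝕜 := ℂ) (abs_ind_le S)).continuous
  unfold alphaDiff
  fun_prop

/-- This is Cauchy's integrand times exp(1 - e^x + α(x)); as n = x e^x, the factor e^(-inθ) is the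
linear term of `saddleExponent`. -/
theorem integral_saddle_mul_exp (S : Set ℕ) (hS : 0 ∉ S) {x : ℝ} (hx : 0 < x) {n : ℕ}
    (hn : x * Real.exp x = n) :
    ∫ θ in -Real.pi..Real.pi, saddle x θ * Complex.exp (alphaDiff S x θ) =
      (2 * Real.pi * x ^ n / n.factorial * Real.exp (1 - Real.exp x) : ℝ) *
        ((numPartitionsAvoiding n S * Real.exp (alpha S x) : ℝ) : ℂ) := by
  have hn' : (n : ℂ) = x * Complex.exp x := by
    rw [← Complex.ofReal_exp]
    exact_mod_cast hn.symm
  have h := integral_genFun S hS n hx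
  have hpt : ∀ θ : ℝ, saddle x θ * Complex.exp (alphaDiff S x θ) =
      Complex.exp (1 - Complex.exp x + egf ℂ (ind S) x) *
        (genFun S (x * Complex.exp (θ * Complex.I)) *
          Complex.exp (-(n * (θ * Complex.I)))) := by
    intro θ
    have h1 : Complex.exp (x * Complex.exp (θ * Complex.I)) =
        Complex.exp x * Complex.exp (x * (Complex.exp (θ * Complex.I) - 1)) := by
      rw [← Complex.exp_add]
      ring_nf
    rw [saddle, saddleExponent, genFun, alphaDiff, ← Complex.exp_add, ← Complex.exp_add,
      ← Complex.exp_add, h1, hn']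
    push_cast
    ring_nf
  simp only [hpt]
  rw [intervalIntegral.integral_const_mul, h, Complex.exp_add]
  push_cast
  rw [ofReal_alpha]
  ring

/-- The relative error of the approximation of the proportion of the partitions of `n` objects
that avoid block sizes in `S` by `exp (-α_S(r n))`. -/
def relError (n : ℕ) (S : Set ℕ) : ℝ :=
  (numPartitionsAvoiding n S : ℝ) / (numPartitions n : ℝ) * Real.exp (alpha S (r n)) - 1

theorem ratio_eq (n : ℕ) (S : Set ℕ) :
    (numPartitionsAvoiding n S : ℝ) / (numPartitions n : ℝ) =
      Real.exp (-alpha S (r n)) * (1 + relError n S) := by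
  rw [relError, add_sub_cancel, mul_comm, mul_assoc, ← Real.exp_add]
  simp

theorem relError_empty (n : ℕ) : relError n ∅ = 0 := by
  have : (numPartitions n : ℝ) ≠ 0 := by exact_mod_cast (numPartitions_pos n).ne'
  rw [relError, numPartitionsAvoiding_empty, alpha_empty, div_self this]
  simp

/-- The case S = ∅ supplies the denominator, and the common Cauchy constant cancels. -/
theorem relError_mul_integral (S : Set ℕ) (hS : 0 ∉ S) {n : ℕ} (hr : 0 < r n) :
    (relError n S : ℂ) * ∫ θ in -Real.pi..Real.pi, saddle (r n) θ =
      ∫ θ in -Real.pi..Real.pi, saddle (r n) θ * (Complex.exp (alphaDiff S (r n) θ) - 1) := by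
  have h1 := integral_saddle_mul_exp S hS hr (r_mul_exp_r n)
  have h2 := integral_saddle_mul_exp ∅ (by simp) hr (r_mul_exp_r n)
  simp only [alphaDiff_empty, Complex.exp_zero, mul_one, alpha_empty, Real.exp_zero,
    numPartitionsAvoiding_empty] at h2
  have hc := continuous_saddle (r n)
  have hc' := continuous_alphaDiff S (r n)
  simp only [mul_sub, mul_one]
  rw [intervalIntegral.integral_sub (Continuous.intervalIntegrable (by fun_prop) _ _)
    (Continuous.intervalIntegrable hc _ _), h1, h2, relError]
  have : (numPartitions n : ℂ) ≠ 0 := by exact_mod_cast (numPartitions_pos n).ne'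
  push_cast
  field_simp

/-! ### Uniform bounds for the relative error -/

theorem r_nonneg (n : ℕ) : 0 ≤ r n := by
  by_contra! h
  have h1 := r_mul_exp_r n
  have h2 := mul_neg_of_neg_of_pos h (Real.exp_pos (r n))
  have h3 : (0 : ℝ) ≤ n := n.cast_nonneg
  linarith

theorem r_le (n : ℕ) : r n ≤ n := by
  have h1 := r_mul_exp_r n
  have h2 := le_mul_of_one_le_right (r_nonneg n) (Real.one_le_exp (r_nonneg n))
  linarith

theorem exists_le_r (x : ℝ) : ∃ N : ℕ, ∀ n, N ≤ n → x ≤ r n := by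
  obtain ⟨N, hN⟩ := exists_nat_ge (x * Real.exp x)
  refine ⟨N, fun n hn => ?_⟩
  by_contra! h
  have hx : 0 < x := (r_nonneg n).trans_lt h
  have h1 : r n * Real.exp (r n) < x * Real.exp x :=
    mul_lt_mul h (Real.exp_le_exp.2 h.le) (Real.exp_pos _) hx.le
  rw [r_mul_exp_r] at h1
  have : (N : ℝ) ≤ n := by exact_mod_cast hn
  linarith

theorem exists_abs_relError_le_of_large {κ D : ℝ} (hκ₀ : 0 ≤ κ) (hκ : κ < 1 / 2) (hD : 0 ≤ D) :
    ∃ (N : ℕ) (C : ℝ), ∀ (n : ℕ) (S : Set ℕ), N ≤ n → 0 ∉ S →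
      deriv (alpha S) (r n) ≤ D * Real.exp (κ * r n) →
      |relError n S| ≤ C * ((1 + deriv (alpha S) (r n) ^ 2) / Real.exp (r n)) := by
  -- `max D 2` lets one bound serve both A = α'(r) and the value A = 2 in the first-moment
  -- remainder.
  obtain ⟨x₁, K, hx₁, hK, hup⟩ :=
    exists_norm_integral_saddle_mul_le hκ₀ hκ (hD.trans (le_max_left D 2))
  obtain ⟨x₂, -, hlow⟩ := exists_le_norm_integral_saddle
  obtain ⟨N, hN⟩ := exists_le_r (max x₁ x₂)
  -- 132 = 3 · (37 + 7): the two remainder constants, and the 1/3 of the denominator.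
  refine ⟨N, 132 * K, fun n S hn hS hA => ?_⟩
  have hx₁' : x₁ ≤ r n := (le_max_left _ _).trans (hN n hn)
  have hx₂' : x₂ ≤ r n := (le_max_right _ _).trans (hN n hn)
  have hx : 1 ≤ r n := hx₁.trans hx₁'
  have hx0 : 0 < r n := by linarith
  have hs := scale_pos hx0
  have hA0 := deriv_alpha_nonneg S hx0.le
  have hmul := relError_mul_integral S hS hx0
  have hnr := r_mul_exp_r n
  have hid := integral_saddle_mul_id hx0 hnr
  set x := r n
  set A := deriv (alpha S) x
  have hexp : 1 ≤ Real.exp (κ * x) := Real.one_le_exp (by positivity)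
  have hA' : A ≤ max D 2 * Real.exp (κ * x) := hA.trans (by gcongr; exact le_max_left _ _)
  have h2' : 2 ≤ max D 2 * Real.exp (κ * x) :=
    (le_max_right D 2).trans (le_mul_of_one_le_right (by positivity) hexp)
  have h1 := hup x A hx₁' hA0 hA' _ _ (by positivity) (norm_exp_alphaDiff_sub_le S hx)
  have h2 := hup x 2 hx₁' (by norm_num) h2' 7 _ (by norm_num) (norm_saddle_deriv_remainder_le hx)
  set I₁ := ∫ θ in -Real.pi..Real.pi, saddle x θ * (θ : ℂ) with hI₁
  set I₂ := ∫ θ in -Real.pi..Real.pi, saddle x θ *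
    (Complex.exp (alphaDiff S x θ) - 1 + θ * (x * A : ℝ) * Complex.I) with hI₂
  set q := Real.exp (-x) / scale x with hq
  have hq0 : 0 < q := by positivity
  have h3 : (1 + x) * ‖I₁‖ ≤ K * 7 * q := by
    rw [← norm_neg, ← hid, norm_mul, norm_mul, Complex.norm_I, mul_one] at h2
    have : ‖(1 : ℂ) + x‖ = 1 + x := by
      rw [← Complex.ofReal_one, ← Complex.ofReal_add, Complex.norm_real,
        Real.norm_of_nonneg (by positivity)]
    rwa [this] at h2
  have hc := continuous_saddle x
  have hc' := continuous_alphaDiff S x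
  have h4 : ∫ θ in -Real.pi..Real.pi, saddle x θ * (Complex.exp (alphaDiff S x θ) - 1) =
      I₂ - (x * A : ℝ) * Complex.I * I₁ := by
    rw [hI₁, hI₂, ← intervalIntegral.integral_const_mul, ← intervalIntegral.integral_sub
      (Continuous.intervalIntegrable (by fun_prop) _ _)
      (Continuous.intervalIntegrable (by fun_prop) _ _)]
    congr 1
    funext θ
    ring
  have h5 : ‖(x * A : ℝ) * Complex.I * I₁‖ ≤ A * (K * 7 * q) := by
    rw [norm_mul, norm_mul, Complex.norm_I, mul_one, Complex.norm_real,
      Real.norm_of_nonneg (by positivity), mul_comm x A, mul_assoc]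
    exact mul_le_mul_of_nonneg_left (by linarith [norm_nonneg I₁]) hA0
  have h6 : |relError n S| * (1 / 3 / scale x) ≤ K * 44 * (1 + A ^ 2) * q := by
    calc |relError n S| * (1 / 3 / scale x)
        ≤ |relError n S| * ‖∫ θ in -Real.pi..Real.pi, saddle x θ‖ := by
          gcongr
          exact hlow x hx₂'
      _ = ‖I₂ - (x * A : ℝ) * Complex.I * I₁‖ := by
          rw [← h4, ← hmul, norm_mul, Complex.norm_real, Real.norm_eq_abs]
      _ ≤ K * (37 * (1 + A ^ 2)) * q + A * (K * 7 * q) := (norm_sub_le _ _).trans (add_le_add h1 h5)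
      _ ≤ K * (37 * (1 + A ^ 2)) * q + (1 + A ^ 2) * (K * 7 * q) := by
          gcongr
          nlinarith [sq_nonneg (A - 1)]
      _ = _ := by ring
  have h7 : q = 3 * (1 / 3 / scale x) / Real.exp x := by
    rw [hq, Real.exp_neg]
    field_simp
  rw [h7] at h6
  refine le_of_mul_le_mul_right (h6.trans (le_of_eq ?_)) (by positivity : 0 < 1 / 3 / scale x)
  ring

theorem alpha_le_exp (S : Set ℕ) {x : ℝ} (hx : 0 ≤ x) : alpha S x ≤ Real.exp x := by
  rw [alpha_eq_egf]
  refine hasSum_le (fun k => ?_) (summable_egf (𝕜 := ℝ) (abs_ind_le S) x).hasSum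
    (hasSum_pow_div_factorial x)
  exact mul_le_of_le_one_left (by positivity) (ind_le_one S k)

/-- A crude bound, uniform in S, for the finitely many n that the saddle-point estimate misses. -/
theorem abs_relError_le (n : ℕ) (S : Set ℕ) :
    |relError n S| ≤ 1 + Real.exp (Real.exp (r n)) := by
  have h1 : (numPartitionsAvoiding n S : ℝ) / (numPartitions n : ℝ) ≤ 1 :=
    div_le_one_of_le₀ (by exact_mod_cast numPartitionsAvoiding_le n S) (by positivity)
  have h2 := Real.exp_le_exp.2 (alpha_le_exp S (r_nonneg n))
  have h3 := mul_le_mul h1 h2 (Real.exp_pos _).le zero_le_one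
  have h4 : 0 ≤ (numPartitionsAvoiding n S : ℝ) / (numPartitions n : ℝ) *
    Real.exp (alpha S (r n)) := by positivity
  rw [relError, abs_le]
  constructor <;> linarith [Real.exp_pos (Real.exp (r n))]

theorem exists_abs_relError_le {κ D : ℝ} (hκ₀ : 0 ≤ κ) (hκ : κ < 1 / 2) (hD : 0 ≤ D) :
    ∃ C : ℝ, 0 ≤ C ∧ ∀ (n : ℕ) (S : Set ℕ), 0 ∉ S →
      deriv (alpha S) (r n) ≤ D * Real.exp (κ * r n) →
      |relError n S| ≤ C * ((1 + deriv (alpha S) (r n) ^ 2) / Real.exp (r n)) := by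
  obtain ⟨N, C, hC⟩ := exists_abs_relError_le_of_large hκ₀ hκ hD
  refine ⟨max C ((1 + Real.exp (Real.exp N)) * Real.exp N), le_max_of_le_right (by positivity),
    fun n S hS hA => ?_⟩
  rcases le_total N n with hn | hn
  · refine (hC n S hn hS hA).trans ?_
    gcongr
    exact le_max_left _ _
  · have hr : r n ≤ N := (r_le n).trans (by exact_mod_cast hn)
    have h1 : 1 / Real.exp N ≤ (1 + deriv (alpha S) (r n) ^ 2) / Real.exp (r n) := by
      gcongr
      linarith [sq_nonneg (deriv (alpha S) (r n))]
    calc |relError n S| ≤ 1 + Real.exp (Real.exp (r n)) := abs_relError_le n S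
      _ ≤ 1 + Real.exp (Real.exp N) := by gcongr
      _ = (1 + Real.exp (Real.exp N)) * Real.exp N * (1 / Real.exp N) := by field_simp
      _ ≤ _ := by
        gcongr
        exact le_max_right _ _

end SetPartitions

end

theorem corollary2 (η₁ η₂ δ₁ δ₂ : ℝ)
    (hη : η₁ < η₂)
    (hη₁ : η₁ * (1 - Real.log η₁) = 1 / 2)
    (hη₂ : η₂ * (1 - Real.log η₂) = 1 / 2)
    (hδ₀ : 0 < δ₁) (hδ₁ : δ₁ < η₁) (hδ₂ : η₂ < δ₂) :
    ∃ E : ℕ → Set ℕ → ℝ,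
      -- `E n S` is the relative error of the approximation of the proportion by `exp (-α(r))`
      (∀ (n : ℕ) (S : Set ℕ), SetPartitions.Admissible δ₁ δ₂ n S →
        (SetPartitions.numPartitionsAvoiding n S : ℝ) / (SetPartitions.numPartitions n : ℝ) =
          Real.exp (-SetPartitions.alpha S (SetPartitions.r n)) * (1 + E n S)) ∧
      -- the error is `O((1 + α'(r) ^ 2) / e ^ r)`, uniformly in `S`
      (∃ C : ℝ, ∀ (n : ℕ) (S : Set ℕ), SetPartitions.Admissible δ₁ δ₂ n S →
        |E n S| ≤ C * ((1 + deriv (SetPartitions.alpha S) (SetPartitions.r n) ^ 2) /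
          Real.exp (SetPartitions.r n))) ∧
      -- it is `O(α'(r) ^ 2 / e ^ r)`, uniformly in the `S` that are empty or have `α'(r) ≥ c`
      (∀ c : ℝ, 0 < c → ∃ C : ℝ, ∀ (n : ℕ) (S : Set ℕ), SetPartitions.Admissible δ₁ δ₂ n S →
        (S = ∅ ∨ c ≤ deriv (SetPartitions.alpha S) (SetPartitions.r n)) →
        |E n S| ≤ C * (deriv (SetPartitions.alpha S) (SetPartitions.r n) ^ 2 /
          Real.exp (SetPartitions.r n))) ∧
      -- it is `o(1)` as `n → ∞`, uniformly in `S`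
      (∀ ε : ℝ, 0 < ε → ∃ N : ℕ, ∀ n : ℕ, N ≤ n →
        ∀ S : Set ℕ, SetPartitions.Admissible δ₁ δ₂ n S → |E n S| ≤ ε) := by
  open SetPartitions in
  obtain ⟨κ, D, hκ₀, hκ, hD, hbound⟩ := exists_deriv_alpha_le hη hη₁ hη₂ hδ₀ hδ₁ hδ₂
  have hA : ∀ (n : ℕ) (S : Set ℕ), Admissible δ₁ δ₂ n S →
      deriv (alpha S) (r n) ≤ D * Real.exp (κ * r n) :=
    fun n S hS => hbound S (r n) (r_nonneg n) hS.2
  obtain ⟨C, hC₀, hC⟩ := exists_abs_relError_le hκ₀.le hκ hD.le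
  have hmain : ∀ (n : ℕ) (S : Set ℕ), Admissible δ₁ δ₂ n S →
      |relError n S| ≤ C * ((1 + deriv (alpha S) (r n) ^ 2) / Real.exp (r n)) :=
    fun n S hS => hC n S hS.1 (hA n S hS)
  refine ⟨relError, fun n S _ => ratio_eq n S, ⟨C, hmain⟩, fun c hc => ?_, fun ε hε => ?_⟩
  -- If α'(r) ≥ c, then 1 ≤ α'(r)²/c². For S = ∅ the error vanishes exactly.
  · refine ⟨C * (1 / c ^ 2 + 1), fun n S hS h => ?_⟩
    rcases h with rfl | h
    · rw [relError_empty, abs_zero]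
      positivity
    · refine (hmain n S hS).trans ?_
      have h1 : c ^ 2 ≤ deriv (alpha S) (r n) ^ 2 := by gcongr
      have h2 : 1 ≤ 1 / c ^ 2 * deriv (alpha S) (r n) ^ 2 := by
        rw [one_div_mul_eq_div, one_le_div (by positivity)]
        exact h1
      rw [mul_assoc, ← mul_div_assoc (1 / c ^ 2 + 1)]
      gcongr
      linarith
  -- Since A ≤ D e^(κr), (1 + A²)e^(-r) is at most e^(-r) + D² e^(-(1 - 2κ)r), which is free of S
  -- and tends to 0 because κ < 1/2.
  · have hlim : Filter.Tendsto (fun x : ℝ => C * (Real.exp (-x) +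
        D ^ 2 * Real.exp (-((1 - 2 * κ) * x)))) Filter.atTop (nhds 0) := by
      have h1 := Real.tendsto_exp_neg_atTop_nhds_zero
      have h2 := h1.comp (Filter.tendsto_id.const_mul_atTop (by linarith : 0 < 1 - 2 * κ))
      simpa using (h1.add (h2.const_mul (D ^ 2))).const_mul C
    obtain ⟨x₀, hx₀⟩ := Filter.eventually_atTop.1 (hlim.eventually_le_const hε)
    obtain ⟨N, hN⟩ := exists_le_r x₀
    refine ⟨N, fun n hn S hS => (hmain n S hS).trans (le_trans ?_ (hx₀ _ (hN n hn)))⟩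
    have h1 := pow_le_pow_left₀ (deriv_alpha_nonneg S (r_nonneg n)) (hA n S hS) 2
    have h2 : Real.exp (κ * r n) ^ 2 = Real.exp (2 * κ * r n) := by
      rw [← Real.exp_nat_mul]
      push_cast
      ring_nf
    rw [mul_pow, h2] at h1
    rw [div_eq_mul_inv, ← Real.exp_neg, add_mul, one_mul]
    have h3 : deriv (alpha S) (r n) ^ 2 * Real.exp (-r n) ≤
        D ^ 2 * Real.exp (-((1 - 2 * κ) * r n)) := by
      calc deriv (alpha S) (r n) ^ 2 * Real.exp (-r n)
          ≤ D ^ 2 * Real.exp (2 * κ * r n) * Real.exp (-r n) := by gcongr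
        _ = _ := by
          rw [mul_assoc, ← Real.exp_add]
          ring_nf
    gcongr
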